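/- Let $M\subseteq B(K)$ be a von Neumann algebra with a faithful normal tracial state $\tau$, let $\|x\|$ denote the operator norm on $M$, $\|x\|_2=\tau(x^*x)^{1/2}$, and let $L^2(M,\tau)$ be the completion of $M$ for $\|\cdot\|_2$. Let $\mathcal H$ be an involutive Hilbert $M$–$M$ $W^*$-bimodule, i.e. a complex Hilbert space with commuting unital left and right $*$-actions of $M$, both $\sigma$-weakly continuous, and an isometric conjugate-linear involution $J:\mathcal H\to\mathcal H$ with $J(x\xi y)=y^*J(\xi)x^*$ for $x,y\in M$, $\xi\in\mathcal H$. Call a linear map $\delta:D\to\mathcal H$ on a $*$-subalgebra $D\subseteq M$ (not required to contain $1$) a *symmetric derivation* if $\delta(xy)=x\,\delta(y)+\delta(x)\,y$ and $\delta(x^*)=J(\delta(x))$ for all $x,y\in D$. Let $\delta$ be a symmetric derivation whose domain $D(\delta)$ is a weakly dense $*$-subalgebra of $M$, and suppose that $\delta$ is closable as an unbounded operator $D(\delta)\subseteq L^2(M,\tau)\to\mathcal H$, with closure $\bar\delta$. Then the following are equivalent: (i) $D(\bar\delta)\cap M$ is a $*$-subalgebra of $M$ and the restriction of $\bar\delta$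 to it is a symmetric derivation. (ii) For every $Z\in D(\bar\delta)\cap M$ there is a sequence $(Z_n)$ in $D(\delta)$ with $\|Z_n\|\le\|Z\|$ for all $n$, $\|Z_n-Z\|_2\to0$ and $\|\delta(Z_n)-\bar\delta(Z)\|_{\mathcal H}\to0$. -/

import Mathlib

open Filter Topology MulOpposite
open scoped InnerProductSpace ComplexOrder

namespace VNDerivation

/-- The σ-weak (ultraweak) topology on `B(K)`: the coarsest topology for which all functionals
`x ↦ ∑ₙ ⟪ξₙ, x ηₙ⟫` with `∑ₙ ‖ξₙ‖² < ∞` and `∑ₙ ‖ηₙ‖² < ∞` are continuous. -/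
@[reducible] noncomputable def sigmaWeak (K : Type*) [NormedAddCommGroup K] [InnerProductSpace ℂ K] :
    TopologicalSpace (K →L[ℂ] K) :=
  TopologicalSpace.induced
    (fun (x : K →L[ℂ] K) (p : lp (fun _ : ℕ => K) 2 × lp (fun _ : ℕ => K) 2) =>
      ∑' n : ℕ, ⟪p.1 n, x (p.2 n)⟫_ℂ)
    inferInstance

section Algebra

variable {K : Type*} [NormedAddCommGroup K] [InnerProductSpace ℂ K] [CompleteSpace K]

/-- The *-algebra of elements of a von Neumann algebra. -/
abbrev Elem (M : VonNeumannAlgebra K) : Type _ := M.toStarSubalgebra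

/-- The σ-weak topology of a von Neumann algebra `M ⊆ B(K)`. -/
@[reducible] noncomputable def sigmaWeakOn (M : VonNeumannAlgebra K) : TopologicalSpace (Elem M) :=
  TopologicalSpace.induced (fun x : Elem M => (x : K →L[ℂ] K)) (sigmaWeak K)

/-- A faithful normal tracial state on a von Neumann algebra. -/
structure FaithfulNormalTrace (M : VonNeumannAlgebra K) where
  toFun : Elem M →ₗ[ℂ] ℂ
  map_one : toFun 1 = 1
  nonneg : ∀ x, 0 ≤ toFun (star x * x)
  faithful : ∀ x, toFun (star x * x) = 0 → x = 0
  tracial : ∀ x y, toFun (x * y) = toFun (y * x)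
  normal : Continuous[sigmaWeakOn M, inferInstance] toFun

variable {M : VonNeumannAlgebra K} (τ : FaithfulNormalTrace M)

theorem FaithfulNormalTrace.map_star (x : Elem M) :
    τ.toFun (star x) = star (τ.toFun x) := by
  have h1 := (Complex.nonneg_iff.mp (τ.nonneg (1 + x))).2
  have h2 := (Complex.nonneg_iff.mp (τ.nonneg (1 + Complex.I • x))).2
  have h3 := (Complex.nonneg_iff.mp (τ.nonneg x)).2
  simp only [star_add, star_one, star_smul, add_mul, mul_add, one_mul, mul_one, map_add,
    map_smul, smul_mul_assoc, mul_smul_comm, τ.map_one, Complex.add_im,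
    Complex.one_im, smul_eq_mul, Complex.mul_im, Complex.I_re, Complex.I_im, Complex.star_def,
    Complex.conj_I, Complex.neg_re, Complex.neg_im, Complex.mul_re] at h1 h2 h3
  apply Complex.ext
  · simp only [Complex.star_def, Complex.conj_re]
    linarith
  · simp only [Complex.star_def, Complex.conj_im]
    linarith

/-- A copy of `M`, to be equipped with the inner product `⟪x, y⟫ = τ(x⋆ y)`. -/
def PreL2 (_ : FaithfulNormalTrace M) : Type _ := Elem M

noncomputable instance : AddCommGroup (PreL2 τ) := inferInstanceAs (AddCommGroup (Elem M))
noncomputable instance : Module ℂ (PreL2 τ) := inferInstanceAs (Module ℂ (Elem M))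

/-- The identity map from `M` to its copy. -/
noncomputable def toPreL2 : Elem M ≃ₗ[ℂ] PreL2 τ := LinearEquiv.refl ℂ _

/-- The inner product `⟪x, y⟫ = τ(x⋆ y)`. -/
@[reducible] noncomputable def preL2Core : InnerProductSpace.Core ℂ (PreL2 τ) where
  inner x y := τ.toFun (star ((toPreL2 τ).symm x) * (toPreL2 τ).symm y)
  conj_inner_symm x y := by
    rw [← Complex.star_def, ← τ.map_star]
    simp
  re_inner_nonneg x := (Complex.nonneg_iff.mp (τ.nonneg _)).1
  add_left x y z := by simp [add_mul]
  smul_left x y r := by simp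
  definite x hx := by
    have := τ.faithful _ hx
    simpa using this

noncomputable instance : NormedAddCommGroup (PreL2 τ) :=
  InnerProductSpace.Core.toNormedAddCommGroup (cd := preL2Core τ)

noncomputable instance : InnerProductSpace ℂ (PreL2 τ) :=
  InnerProductSpace.ofCore (preL2Core τ).toCore

/-- `L²(M, τ)`, the completion of `M` for the norm `‖x‖₂ = τ(x⋆ x)^(1/2)`. -/
abbrev L2 : Type _ := UniformSpace.Completion (PreL2 τ)

/-- The canonical map `M → L²(M, τ)`. -/
noncomputable def toL2 : Elem M →ₗ[ℂ] L2 τ :=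
  (UniformSpace.Completion.toComplL (𝕜 := ℂ) (E := PreL2 τ)).toLinearMap ∘ₗ
    (toPreL2 τ).toLinearMap

theorem toL2_injective : Function.Injective (toL2 τ) :=
  (UniformSpace.Completion.coe_injective (PreL2 τ)).comp (toPreL2 τ).injective

theorem inner_toL2 (x y : Elem M) : ⟪toL2 τ x, toL2 τ y⟫_ℂ = τ.toFun (star x * y) :=
  UniformSpace.Completion.inner_coe (𝕜 := ℂ) (toPreL2 τ x) (toPreL2 τ y)

end Algebra

section Bimodule

variable {K : Type*} [NormedAddCommGroup K] [InnerProductSpace ℂ K] [CompleteSpace K]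

/-- An involutive `M`–`M` Hilbert `W*`-bimodule structure on a Hilbert space `H`: commuting,
σ-weakly continuous, unital left and right *-actions of `M` and an isometric conjugate-linear
involution `J` with `J(x ξ y) = y⋆ J(ξ) x⋆`. -/
structure InvolutiveBimodule (M : VonNeumannAlgebra K) (H : Type*) [NormedAddCommGroup H]
    [InnerProductSpace ℂ H] [CompleteSpace H] where
  left : Elem M →⋆ₐ[ℂ] (H →L[ℂ] H)
  right : (Elem M)ᵐᵒᵖ →⋆ₐ[ℂ] (H →L[ℂ] H)
  left_right_comm : ∀ (x y : Elem M) (ξ : H), left x (right (op y) ξ) = right (op y) (left x ξ)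
  left_normal : Continuous[sigmaWeakOn M, sigmaWeak H] left
  right_normal : Continuous[sigmaWeakOn M, sigmaWeak H] fun x : Elem M => right (op x)
  J : H →ₗᵢ⋆[ℂ] H
  J_J : ∀ ξ, J (J ξ) = ξ
  J_act : ∀ (x y : Elem M) (ξ : H),
    J (left x (right (op y) ξ)) = left (star y) (right (op (star x)) (J ξ))

variable {M : VonNeumannAlgebra K} {H : Type*} [NormedAddCommGroup H]
  [InnerProductSpace ℂ H] [CompleteSpace H]

/-- A symmetric derivation `δ : D(δ) → H`, defined on a (not necessarily unital) *-subalgebra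
`D(δ)` of `M`: a linear map with `δ(x y) = x δ(y) + δ(x) y` and `δ(x⋆) = J(δ(x))`. -/
structure SymmetricDerivation (B : InvolutiveBimodule M H) where
  domain : NonUnitalStarSubalgebra ℂ (Elem M)
  toFun : domain →ₗ[ℂ] H
  leibniz : ∀ x y : domain,
    toFun (x * y) = B.left (x : Elem M) (toFun y) + B.right (op (y : Elem M)) (toFun x)
  symmetric : ∀ x : domain, toFun (star x) = B.J (toFun x)

namespace SymmetricDerivation

variable {B : InvolutiveBimodule M H} (δ : SymmetricDerivation B)

/-- `D(δ)` is dense in `M` for the weak operator topology. -/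
def WeaklyDense : Prop :=
  ∀ x : Elem M, ContinuousLinearMapWOT.ofCLM (x : K →L[ℂ] K) ∈
    closure (Set.range fun d : δ.domain =>
      ContinuousLinearMapWOT.ofCLM (σ := RingHom.id ℂ) ((d : Elem M) : K →L[ℂ] K))

/-- `δ` as an unbounded operator `D(δ) ⊆ L²(M, τ) → H`. -/
noncomputable def toLinearPMap (τ : FaithfulNormalTrace M) : L2 τ →ₗ.[ℂ] H where
  domain := δ.domain.toSubmodule.map (toL2 τ)
  toFun := δ.toFun ∘ₗ
    (Submodule.equivMapOfInjective (toL2 τ) (toL2_injective τ)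
      δ.domain.toSubmodule).symm.toLinearMap

theorem toLinearPMap_apply (τ : FaithfulNormalTrace M) (x : δ.domain)
    (hx : toL2 τ x ∈ (δ.toLinearPMap τ).domain) :
    δ.toLinearPMap τ ⟨toL2 τ x, hx⟩ = δ.toFun x :=
  congrArg δ.toFun ((LinearEquiv.symm_apply_eq _).2 (Subtype.ext rfl))

/-- The closure `δ̄` of `δ` as an unbounded operator from `L²(M, τ)` to `H`. -/
noncomputable def bar (τ : FaithfulNormalTrace M) : L2 τ →ₗ.[ℂ] H :=
  (δ.toLinearPMap τ).closure

end SymmetricDerivation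

end Bimodule

end VNDerivation

open VNDerivation

/-! Statement (ii) is a Kaplansky density theorem for the graph norm (`exists_seq_unit_ball`). Let
`‖Z‖ ≤ 1` and let `X n` in the domain tend to `Z` in graph norm. Replace `X n` by `Y n = X n *
q(star (X n) * X n)`, where `t q(t²)` is an odd polynomial close to the truncation of `t` at `1` on
an interval `[0, R]` with `‖X n‖ ≤ R`; then `‖Y n‖ ≤ 1`. Being odd, it has no constant term, so `Y
n` stays in a domain that need not contain `1`.

The derivative of `t q(t²)` is at most `2`, whatever `R` is. On a Hilbert space with commuting left
and right actions, a divided difference is a function of two commuting self-adjoint operators, so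
its norm is controlled by a supremum of scalars, and a scalar derivative bound becomes an operator
Lipschitz bound (`norm_sum_smul_le`). Used on `H`, this bounds `δ(Y n)` by a multiple of `δ(X n)`;
used on `L²(M, τ)`, it gives `Y n → Z` in `‖·‖₂`. A weak limit point of `δ(Y n)` must be `δ̄(Z)`,
because the graph of `δ̄` is closed and convex, hence weakly closed. Convex combinations, which
preserve the unit ball, then turn weak into norm convergence.

Conversely, for norm-bounded approximants `‖·‖₂`-convergence implies σ-weak convergence, so both
normal actions pass to the limit in the Leibniz rule and the weakly closed graph contains the
product (`mul_mem_graph_bar`). The involution is isometric for both norms. -/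

namespace VNDerivation

/-! ### Noncommutative divided differences of polynomials. -/

/-- The sum `∑_{i + j = k - 1} lⁱ rʲ` (with `r` on the left), so that
`l ^ k - r ^ k = (l - r) * divDiffPow k l r` for commuting `l`, `r`. -/
def divDiffPow {A : Type*} [Semiring A] : ℕ → A → A → A
  | 0, _, _ => 0
  | k + 1, l, r => r * divDiffPow k l r + l ^ k

/-- The divided difference `(q(l) - q(r)) / (l - r)` of a real polynomial. -/
noncomputable def divDiff {A : Type*} [Semiring A] [Algebra ℝ A] (q : Polynomial ℝ) (l r : A) : A :=
  ∑ k ∈ Finset.range (q.natDegree + 1), q.coeff k • divDiffPow k l r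

section Algebraic

variable {A : Type*} [Ring A]

theorem map_divDiffPow {B F : Type*} [Ring B] [FunLike F A B] [RingHomClass F A B] (φ : F)
    (k : ℕ) (l r : A) : φ (divDiffPow k l r) = divDiffPow k (φ l) (φ r) := by
  induction k with
  | zero => simp [divDiffPow]
  | succ k ih => simp [divDiffPow, ih]

/-- With `r = b * star b` and `r' = star b * b`, this moves `b` across a divided difference;
`mul_divDiffPow` does the same for `a` on the other side. -/
theorem divDiffPow_mul {k : ℕ} {l r r' b : A} (hl : Commute l b) (hr : r * b = b * r') :
    divDiffPow k l r * b = b * divDiffPow k l r' := by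
  induction k with
  | zero => simp [divDiffPow]
  | succ k ih =>
    simp only [divDiffPow, add_mul, mul_add, mul_assoc, ih, (hl.pow_left k).eq]
    simp only [← mul_assoc, hr]

theorem mul_divDiffPow {k : ℕ} {l l' r a : A} (hl : a * l = l' * a) (hr : Commute a r) :
    a * divDiffPow k l r = divDiffPow k l' r * a := by
  induction k with
  | zero => simp [divDiffPow]
  | succ k ih =>
    have h : a * l ^ k = l' ^ k * a := SemiconjBy.pow_right hl k
    simp only [divDiffPow, add_mul, mul_add, mul_assoc, ← ih, h]
    simp only [← mul_assoc, hr.eq]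

theorem star_divDiffPow [StarRing A] {k : ℕ} {l r : A} (hl : IsSelfAdjoint l)
    (hr : IsSelfAdjoint r) (h : Commute l r) :
    star (divDiffPow k l r) = divDiffPow k l r := by
  induction k with
  | zero => simp [divDiffPow]
  | succ k ih =>
    simp [divDiffPow, ih, hl.star_eq, hr.star_eq, divDiffPow_mul h rfl]

variable [Algebra ℝ A]

theorem divDiff_mul {q : Polynomial ℝ} {l r r' b : A} (hl : Commute l b) (hr : r * b = b * r') :
    divDiff q l r * b = b * divDiff q l r' := by
  simp only [divDiff, Finset.sum_mul, Finset.mul_sum, smul_mul_assoc, mul_smul_comm,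
    divDiffPow_mul hl hr]

theorem mul_divDiff {q : Polynomial ℝ} {l l' r a : A} (hl : a * l = l' * a) (hr : Commute a r) :
    a * divDiff q l r = divDiff q l' r * a := by
  simp only [divDiff, Finset.sum_mul, Finset.mul_sum, smul_mul_assoc, mul_smul_comm,
    mul_divDiffPow hl hr]

theorem star_divDiff [StarRing A] [StarModule ℝ A] {q : Polynomial ℝ} {l r : A}
    (hl : IsSelfAdjoint l) (hr : IsSelfAdjoint r) (h : Commute l r) :
    star (divDiff q l r) = divDiff q l r := by
  simp [divDiff, star_sum, star_divDiffPow hl hr h]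

end Algebraic

theorem sub_mul_divDiffPow {A : Type*} [CommRing A] (k : ℕ) (l r : A) :
    (l - r) * divDiffPow k l r = l ^ k - r ^ k := by
  induction k with
  | zero => simp [divDiffPow]
  | succ k ih =>
    simp only [divDiffPow]
    linear_combination r * ih

theorem sub_mul_divDiff (q : Polynomial ℝ) (s t : ℝ) :
    (s - t) * divDiff q s t = q.eval s - q.eval t := by
  simp only [divDiff, Finset.mul_sum, smul_eq_mul, Polynomial.eval_eq_sum_range,
    ← Finset.sum_sub_distrib, ← mul_sub, ← sub_mul_divDiffPow]
  exact Finset.sum_congr rfl fun _ _ => by ring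

theorem divDiff_self (q : Polynomial ℝ) (s : ℝ) : divDiff q s s = q.derivative.eval s := by
  have h : ∀ k, divDiffPow k s s = k * s ^ (k - 1) := by
    intro k
    induction k with
    | zero => simp [divDiffPow]
    | succ k ih =>
      rcases k with _ | k
      · simp [divDiffPow]
      · simp only [divDiffPow] at ih ⊢
        rw [ih]
        push_cast
        ring_nf
  rw [Polynomial.derivative_eval, Polynomial.sum_over_range _ (by simp)]
  simp only [divDiff, smul_eq_mul, h, mul_assoc]

theorem ofReal_divDiff (q : Polynomial ℝ) (s t : ℝ) :
    ((divDiff q s t : ℝ) : ℂ) = divDiff q (s : ℂ) (t : ℂ) := by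
  simp only [divDiff, Complex.ofReal_sum, smul_eq_mul, Complex.real_smul, Complex.ofReal_mul]
  exact Finset.sum_congr rfl fun k _ => congrArg _ (map_divDiffPow Complex.ofRealHom k s t)

/-! ### Scalar bounds from a bounded derivative. -/

/-- Bounds for `q` and its divided difference from a bound for the derivative of
`p(t) = t q(t²)`. -/
theorem abs_le_of_deriv_le {q : Polynomial ℝ} {C R : ℝ}
    (hC : ∀ u ∈ Set.Icc 0 R, |deriv (fun t => t * q.eval (t ^ 2)) u| ≤ C)
    {a b : ℝ} (ha : a ∈ Set.Icc 0 R) (hb : b ∈ Set.Icc 0 R) :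
    |q.eval (b ^ 2)| ≤ C ∧ |a * (a + b) * divDiff q (a ^ 2) (b ^ 2)| ≤ 2 * C := by
  have hd : ∀ u, HasDerivAt (fun t => t * q.eval (t ^ 2))
      (q.eval (u ^ 2) + u * (q.derivative.eval (u ^ 2) * (2 * u))) u := by
    intro u
    have h2 : HasDerivAt (fun t : ℝ => t ^ 2) (2 * u) u := by simpa using hasDerivAt_pow 2 u
    have h3 := (q.hasDerivAt (u ^ 2)).comp u h2
    have h4 := (hasDerivAt_id u).mul h3
    rw [one_mul] at h4
    exact h4
  -- The expression is the difference quotient of `t q(t²)` between `a` and `b`, or its derivative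
  -- when `a = b`.
  have key : ∀ a ∈ Set.Icc 0 R, ∀ b ∈ Set.Icc 0 R,
      |q.eval (b ^ 2) + a * (a + b) * divDiff q (a ^ 2) (b ^ 2)| ≤ C := by
    intro a ha b hb
    by_cases hab : a = b
    · subst hab
      have := hC a ha
      rw [(hd a).deriv] at this
      rw [divDiff_self]
      convert this using 2
      ring
    · have h1 := (convex_Icc 0 R).norm_image_sub_le_of_norm_deriv_le
        (fun u _ => (hd u).differentiableAt) hC hb ha
      have h2 : (a * q.eval (a ^ 2) - b * q.eval (b ^ 2)) =
          (q.eval (b ^ 2) + a * (a + b) * divDiff q (a ^ 2) (b ^ 2)) * (a - b) := by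
        have := sub_mul_divDiff q (a ^ 2) (b ^ 2)
        linear_combination -a * this
      rw [h2, norm_mul] at h1
      exact le_of_mul_le_mul_right h1 (norm_pos_iff.2 (sub_ne_zero.2 hab))
  have h0 : (0 : ℝ) ∈ Set.Icc 0 R := ⟨le_rfl, ha.1.trans ha.2⟩
  -- At `a = 0` only `q(b²)` survives; subtracting it from the general case costs a second `C`.
  have h1 : |q.eval (b ^ 2)| ≤ C := by simpa using key 0 h0 b hb
  refine ⟨h1, ?_⟩
  have h2 := key a ha b hb
  rw [abs_le] at *
  constructor <;> linarith [h1.1, h1.2, h2.1, h2.2]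

/-- With `s = a²` and `t = b²`, the bound on `a(a + b)|Q|` dominates both `a²|Q|` and `ab|Q|`. The
latter appears squared so that no square roots of operators are needed. -/
theorem abs_mul_divDiff_le {q : Polynomial ℝ} {C R : ℝ} (hR : 0 ≤ R)
    (hC : ∀ u ∈ Set.Icc 0 R, |deriv (fun t => t * q.eval (t ^ 2)) u| ≤ C)
    {s t : ℝ} (hs : s ∈ Set.Icc 0 (R ^ 2)) (ht : t ∈ Set.Icc 0 (R ^ 2)) :
    |q.eval t| ≤ C ∧ |divDiff q s t * s| ≤ 2 * C ∧
      |s * t * (divDiff q s t * divDiff q s t)| ≤ (2 * C) ^ 2 := by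
  have hs' : √s ∈ Set.Icc 0 R := ⟨Real.sqrt_nonneg s, Real.sqrt_le_left hR |>.2 hs.2⟩
  have ht' : √t ∈ Set.Icc 0 R := ⟨Real.sqrt_nonneg t, Real.sqrt_le_left hR |>.2 ht.2⟩
  obtain ⟨h1, h2⟩ := abs_le_of_deriv_le hC hs' ht'
  rw [Real.sq_sqrt ht.1] at h1
  rw [Real.sq_sqrt ht.1, Real.sq_sqrt hs.1, abs_mul,
    abs_of_nonneg (mul_nonneg hs'.1 (add_nonneg hs'.1 ht'.1))] at h2
  set d := |divDiff q s t| with hd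
  have hd0 : 0 ≤ d := abs_nonneg _
  have hss := Real.mul_self_sqrt hs.1
  have htt := Real.mul_self_sqrt ht.1
  have hst : 0 ≤ √s * √t := mul_nonneg hs'.1 ht'.1
  refine ⟨h1, ?_, ?_⟩
  · rw [abs_mul, abs_of_nonneg hs.1, ← hd]
    nlinarith [mul_nonneg hst hd0]
  · rw [abs_mul, abs_mul, abs_mul (divDiff q s t), abs_of_nonneg hs.1, abs_of_nonneg ht.1, ← hd]
    have h3 : √s * √t * d ≤ 2 * C := by nlinarith [mul_nonneg hs.1 hd0]
    calc s * t * (d * d) = (√s * √t * d) ^ 2 := by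
          rw [← hss, ← htt]; simp only [Real.sqrt_mul_self hs'.1, Real.sqrt_mul_self ht'.1]; ring
      _ ≤ (2 * C) ^ 2 := pow_le_pow_left₀ (mul_nonneg hst hd0) h3 2

/-! ### Transfer of scalar bounds to C⋆-algebras. -/

/-- Joint functional calculus of two commuting self-adjoint elements. -/
theorem exists_joint_calculus {A : Type*} [CStarAlgebra A] {S T : A} (hS : IsSelfAdjoint S)
    (hT : IsSelfAdjoint T) (h : Commute S T) :
    ∃ (Ω : Set ℂ) (φ : C(Ω, ℂ) →⋆ₐ[ℂ] A) (f g : C(Ω, ℂ)), CompactSpace Ω ∧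
      φ f = S ∧ φ g = T ∧
      (∀ (k : C(Ω, ℂ)) (C : ℝ), 0 ≤ C → (∀ z, ‖k z‖ ≤ C) → ‖φ k‖ ≤ C) ∧
      (∀ z, ∃ s ∈ spectrum ℝ S, f z = (s : ℂ)) ∧ (∀ z, ∃ t ∈ spectrum ℝ T, g z = (t : ℂ)) := by
  -- `S` and `T` are the real and imaginary parts of a normal element, so its continuous functional
  -- calculus serves both.
  set N : A := S + Complex.I • T with hN
  have hsN : star N = S - Complex.I • T := by
    simp [hN, hS.star_eq, hT.star_eq, sub_eq_add_neg]
  have hn : IsStarNormal N := by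
    constructor
    rw [hsN, hN]
    simp only [commute_iff_eq, mul_add, add_mul, mul_sub, sub_mul, smul_mul_assoc,
      mul_smul_comm, h.eq, smul_add, smul_sub]
    abel
  let φ : C(spectrum ℂ N, ℂ) →⋆ₐ[ℂ] A := cfcHom hn
  let i : C(spectrum ℂ N, ℂ) := (ContinuousMap.id ℂ).restrict (spectrum ℂ N)
  have hi : φ i = N := cfcHom_id hn
  let f : C(spectrum ℂ N, ℂ) := ⟨fun z => ((z : ℂ).re : ℂ), by fun_prop⟩
  let g : C(spectrum ℂ N, ℂ) := ⟨fun z => ((z : ℂ).im : ℂ), by fun_prop⟩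
  have hf : f = (2⁻¹ : ℂ) • (i + star i) := by
    ext z
    simp [f, i, Complex.re_eq_add_conj, div_eq_inv_mul]
  have hg : g = (2⁻¹ * -Complex.I : ℂ) • (i - star i) := by
    ext z
    simp only [g, i, ContinuousMap.coe_mk, Complex.im_eq_sub_conj, ContinuousMap.coe_smul,
      ContinuousMap.coe_sub, Pi.smul_apply, Pi.sub_apply, ContinuousMap.star_apply, smul_eq_mul,
      ContinuousMap.restrict_apply, ContinuousMap.id_apply, Complex.star_def]
    field_simp
    rw [Complex.I_sq]
    ring
  have hφf : φ f = S := by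
    rw [hf, map_smul, map_add, map_star, hi, hsN, hN, add_add_sub_cancel, ← two_smul ℂ, smul_smul]
    simp
  have hφg : φ g = T := by
    rw [hg, map_smul, map_sub, map_star, hi, hsN, hN, add_sub_sub_cancel, ← two_smul ℂ, smul_smul,
      smul_smul]
    convert one_smul ℂ T using 2
    linear_combination -Complex.I_sq
  have hspec : ∀ (k : C(spectrum ℂ N, ℂ)) (a : A), φ k = a → IsSelfAdjoint a → ∀ z,
      ∃ s ∈ spectrum ℝ a, k z = (s : ℂ) := by
    intro k a hk ha z
    have h1 : k z ∈ spectrum ℂ a := by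
      rw [← hk, cfcHom_map_spectrum hn k]
      exact ⟨z, rfl⟩
    rw [← ha.spectrumRestricts.algebraMap_image] at h1
    obtain ⟨s, hs, hsz⟩ := h1
    exact ⟨s, hs, hsz.symm⟩
  refine ⟨spectrum ℂ N, φ, f, g, inferInstance, hφf, hφg, ?_, hspec f S hφf hS, hspec g T hφg hT⟩
  intro k C hC hk
  have := (isometry_cfcHom N hn).norm_map_of_map_zero (map_zero _) k
  rw [show ‖φ k‖ = ‖k‖ from this]
  exact (ContinuousMap.norm_le k hC).2 hk

section Estimates

variable {A : Type*} [CStarAlgebra A]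

theorem spectrum_star_mul_self_subset {a : A} {R : ℝ} (ha : ‖a‖ ≤ R) :
    spectrum ℝ (star a * a) ⊆ Set.Icc 0 (R ^ 2) := by
  intro s hs
  have : Nontrivial A := by
    by_contra hA
    rw [not_nontrivial_iff_subsingleton] at hA
    simp [spectrum.of_subsingleton] at hs
  refine ⟨spectrum_star_mul_self_nonneg s hs, (le_abs_self s).trans ?_⟩
  refine (spectrum.norm_le_norm_of_mem hs).trans ?_
  rw [CStarRing.norm_star_mul_self, ← sq]
  exact pow_le_pow_left₀ (norm_nonneg _) ha 2

theorem spectrum_mul_star_self_subset {a : A} {R : ℝ} (ha : ‖a‖ ≤ R) :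
    spectrum ℝ (a * star a) ⊆ Set.Icc 0 (R ^ 2) := by
  simpa using spectrum_star_mul_self_subset (a := star a) (by simpa using ha)

theorem map_real_smul_of_tower {A B : Type*} [Ring A] [StarRing A] [Algebra ℂ A]
    [Algebra ℝ A] [IsScalarTower ℝ ℂ A] [Ring B] [StarRing B] [Algebra ℂ B] [Algebra ℝ B]
    [IsScalarTower ℝ ℂ B] (φ : A →⋆ₐ[ℂ] B) (c : ℝ) (x : A) : φ (c • x) = c • φ x :=
  LinearMap.map_smul_of_tower φ.toAlgHom.toLinearMap c x

theorem star_hom_map_divDiff {A B : Type*} [Ring A] [StarRing A] [Algebra ℂ A]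
    [Algebra ℝ A] [IsScalarTower ℝ ℂ A] [Ring B] [StarRing B] [Algebra ℂ B] [Algebra ℝ B]
    [IsScalarTower ℝ ℂ B] (φ : A →⋆ₐ[ℂ] B) (q : Polynomial ℝ) (l r : A) :
    φ (divDiff q l r) = divDiff q (φ l) (φ r) := by
  rw [divDiff, divDiff, map_sum]
  exact Finset.sum_congr rfl fun k _ =>
    (map_real_smul_of_tower φ _ _).trans (congrArg _ (map_divDiffPow φ k l r))

theorem star_hom_map_aeval {A B : Type*} [Ring A] [StarRing A] [Algebra ℂ A]
    [Algebra ℝ A] [IsScalarTower ℝ ℂ A] [Ring B] [StarRing B] [Algebra ℂ B] [Algebra ℝ B]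
    [IsScalarTower ℝ ℂ B] (φ : A →⋆ₐ[ℂ] B) (q : Polynomial ℝ) (l : A) :
    φ (Polynomial.aeval l q) = Polynomial.aeval (φ l) q := by
  simp only [Polynomial.aeval_eq_sum_range, map_sum, map_real_smul_of_tower φ, map_pow]

theorem continuousMap_divDiff_apply {Ω : Type*} [TopologicalSpace Ω] (q : Polynomial ℝ)
    (f g : C(Ω, ℂ)) (z : Ω) : divDiff q f g z = divDiff q (f z) (g z) :=
  star_hom_map_divDiff (ContinuousMap.evalStarAlgHom ℂ ℂ z) q f g

theorem continuousMap_aeval_apply {Ω : Type*} [TopologicalSpace Ω] (q : Polynomial ℝ)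
    (f : C(Ω, ℂ)) (z : Ω) : Polynomial.aeval f q z = Polynomial.aeval (f z) q :=
  star_hom_map_aeval (ContinuousMap.evalStarAlgHom ℂ ℂ z) q f

theorem norm_divDiff_estimates {q : Polynomial ℝ} {C R : ℝ} (hR : 0 ≤ R)
    (hC : ∀ u ∈ Set.Icc 0 R, |deriv (fun t => t * q.eval (t ^ 2)) u| ≤ C)
    {S T : A} (hS : IsSelfAdjoint S) (hT : IsSelfAdjoint T) (h : Commute S T)
    (hS' : spectrum ℝ S ⊆ Set.Icc 0 (R ^ 2)) (hT' : spectrum ℝ T ⊆ Set.Icc 0 (R ^ 2)) :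
    ‖Polynomial.aeval T q‖ ≤ C ∧ ‖divDiff q S T * S‖ ≤ 2 * C ∧
      ‖S * T * (divDiff q S T * divDiff q S T)‖ ≤ (2 * C) ^ 2 := by
  have hC0 : 0 ≤ C := (abs_nonneg _).trans (hC 0 ⟨le_rfl, hR⟩)
  obtain ⟨Ω, φ, f, g, hΩ, rfl, rfl, hφ, hf, hg⟩ := exists_joint_calculus hS hT h
  simp only [← star_hom_map_divDiff, ← star_hom_map_aeval, ← map_mul]
  refine ⟨hφ _ _ hC0 fun z => ?_, hφ _ _ (by linarith) fun z => ?_, hφ _ _ (sq_nonneg _) fun z => ?_⟩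
  all_goals
    obtain ⟨s, hs, hfz⟩ := hf z
    obtain ⟨t, ht, hgz⟩ := hg z
    obtain ⟨h1, h2, h3⟩ := abs_mul_divDiff_le hR hC (hS' hs) (hT' ht)
  · rw [continuousMap_aeval_apply, hgz]
    have : Polynomial.aeval (t : ℂ) q = ((q.eval t : ℝ) : ℂ) :=
      Polynomial.aeval_algebraMap_apply_eq_algebraMap_eval t q
    rwa [this, Complex.norm_real]
  · rw [ContinuousMap.mul_apply, continuousMap_divDiff_apply, hfz, hgz, ← ofReal_divDiff,
      ← Complex.ofReal_mul, Complex.norm_real]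
    exact h2
  · simp only [ContinuousMap.mul_apply, continuousMap_divDiff_apply, hfz, hgz, ← ofReal_divDiff,
      ← Complex.ofReal_mul, Complex.norm_real]
    exact h3

/-- The three operator bounds needed to estimate a derivation on `x q(x⋆ x)`. -/
theorem norm_mul_divDiff_mul_le {q : Polynomial ℝ} {C R : ℝ}
    (hC : ∀ u ∈ Set.Icc 0 R, |deriv (fun t => t * q.eval (t ^ 2)) u| ≤ C)
    {a b : A} (ha : ‖a‖ ≤ R) (hb : ‖b‖ ≤ R) (hab : Commute a b) (hab' : Commute a (star b)) :
    ‖Polynomial.aeval (b * star b) q‖ ≤ C ∧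
      ‖a * divDiff q (star a * a) (b * star b) * star a‖ ≤ 2 * C ∧
      ‖a * divDiff q (star a * a) (b * star b) * b‖ ≤ 2 * C := by
  have hR : 0 ≤ R := (norm_nonneg a).trans ha
  have hC0 : 0 ≤ C := (abs_nonneg _).trans (hC 0 ⟨le_rfl, hR⟩)
  have hsab : Commute (star a) b := by simpa using hab'.star_star
  have hsab' : Commute (star a) (star b) := hab.star_star
  have c1 : Commute a (b * star b) := hab.mul_right hab'
  have c2 : Commute (star a) (b * star b) := hsab.mul_right hsab'
  have c3 : Commute (star a * a) b := hsab.mul_left hab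
  have c4 : Commute (star a * a) (star b) := hsab'.mul_left hab'
  have e1 := norm_divDiff_estimates hR hC (IsSelfAdjoint.mul_star_self a)
    (IsSelfAdjoint.mul_star_self b) (c1.mul_left c2)
    (spectrum_mul_star_self_subset ha) (spectrum_mul_star_self_subset hb)
  have e2 := norm_divDiff_estimates hR hC (IsSelfAdjoint.star_mul_self a)
    (IsSelfAdjoint.star_mul_self b) (c4.mul_right c3)
    (spectrum_star_mul_self_subset ha) (spectrum_star_mul_self_subset hb)
  refine ⟨e1.1, ?_, ?_⟩
  -- Moving `a` to the right turns the product into `Q(a a⋆, b b⋆) a a⋆`, a function of two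
  -- commuting self-adjoint elements.
  · rw [mul_divDiff (l' := a * star a) (mul_assoc _ _ _).symm c1, mul_assoc]
    exact e1.2.1
  -- Here `a Q b = a b Q(a⋆ a, b⋆ b)` is not self-adjoint in general; the C⋆-identity reduces it to
  -- `a⋆ a b⋆ b Q²`.
  · rw [mul_assoc, divDiff_mul (r' := star b * b) c3 (mul_assoc _ _ _)]
    set d := divDiff q (star a * a) (star b * b) with hd
    have hsd : star d = d := star_divDiff (IsSelfAdjoint.star_mul_self a)
      (IsSelfAdjoint.star_mul_self b) (c4.mul_right c3)
    have hda : Commute (star a * a) d := by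
      have := mul_divDiff (q := q) (a := star a * a) (l := star a * a) (l' := star a * a)
        (r := star b * b) rfl (c4.mul_right c3)
      exact this
    have hdb : Commute (star b * b) d := by
      have := divDiff_mul (q := q) (b := star b * b) (l := star a * a) (r := star b * b)
        (r' := star b * b) (c4.mul_right c3) rfl
      exact this.symm
    refine le_of_sq_le_sq ?_ (by linarith)
    rw [sq, ← CStarRing.norm_star_mul_self]
    have : star (a * (b * d)) * (a * (b * d)) = star a * a * (star b * b) * (d * d) := by
      calc star (a * (b * d)) * (a * (b * d)) = d * (star b * (star a * a * b)) * d := by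
            simp only [star_mul, hsd, mul_assoc]
        _ = d * (star a * a * (star b * b)) * d := by
            rw [c3.eq, ← mul_assoc (star b), ← (c4.mul_right c3).eq]
        _ = _ := by rw [← (hda.mul_left hdb).eq, mul_assoc]
    rw [this]
    exact e2.2.2

/-- By the C⋆-identity the squared norm is that of `S q(S)²` with `S = x⋆ x`, whose spectral values
are `(√s q(s))²`. -/
theorem norm_mul_aeval_le {q : Polynomial ℝ} {C : ℝ} (hC0 : 0 ≤ C) {x : A} {R : ℝ} (hx : ‖x‖ ≤ R)
    (hC : ∀ u ∈ Set.Icc 0 R, |u * q.eval (u ^ 2)| ≤ C) :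
    ‖x * Polynomial.aeval (star x * x) q‖ ≤ C := by
  have hR : 0 ≤ R := (norm_nonneg x).trans hx
  set S := star x * x
  have hS : IsSelfAdjoint S := IsSelfAdjoint.star_mul_self x
  obtain ⟨Ω, φ, f, g, hΩ, hφf, -, hφ, hf, -⟩ := exists_joint_calculus hS hS rfl
  have hq : IsSelfAdjoint (Polynomial.aeval S q) := by
    simp [IsSelfAdjoint, Polynomial.aeval_eq_sum_range, star_sum, hS.star_eq]
  refine le_of_sq_le_sq ?_ hC0
  rw [sq, ← CStarRing.norm_star_mul_self, star_mul, hq.star_eq]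
  rw [show Polynomial.aeval S q * star x * (x * Polynomial.aeval S q) =
    Polynomial.aeval S q * S * Polynomial.aeval S q by simp only [S, mul_assoc], ← hφf,
    ← star_hom_map_aeval, ← map_mul, ← map_mul]
  refine hφ _ _ (sq_nonneg _) fun z => ?_
  obtain ⟨s, hs, hfz⟩ := hf z
  have hs' := spectrum_star_mul_self_subset hx hs
  have h1 := hC (√s) ⟨Real.sqrt_nonneg s, Real.sqrt_le_left hR |>.2 hs'.2⟩
  have : Polynomial.aeval (s : ℂ) q = ((q.eval s : ℝ) : ℂ) :=
    Polynomial.aeval_algebraMap_apply_eq_algebraMap_eval s q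
  simp only [ContinuousMap.mul_apply, continuousMap_aeval_apply, hfz, this, ← Complex.ofReal_mul,
    Complex.norm_real, Real.norm_eq_abs]
  rw [Real.sq_sqrt hs'.1] at h1
  have h2 := pow_le_pow_left₀ (abs_nonneg _) h1 2
  rw [sq_abs, mul_pow, Real.sq_sqrt hs'.1] at h2
  rw [abs_of_nonneg (by nlinarith [mul_nonneg hs'.1 (sq_nonneg (q.eval s))])]
  linarith

end Estimates

/-! ### Polynomial approximation of the truncation. -/

/-- Every real polynomial is the derivative of some `t q(t²)`, after the substitution `t ↦ t²`. -/
theorem exists_deriv_mul_eval_sq_eq (κ : Polynomial ℝ) :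
    ∃ q : Polynomial ℝ, ∀ u, HasDerivAt (fun t => t * q.eval (t ^ 2)) (κ.eval (u ^ 2)) u := by
  induction κ using Polynomial.induction_on' with
  | add p q hp hq =>
    obtain ⟨p', hp'⟩ := hp
    obtain ⟨q', hq'⟩ := hq
    refine ⟨p' + q', fun u => ?_⟩
    have h := (hp' u).add (hq' u)
    simp only [Polynomial.eval_add, mul_add]
    exact h
  | monomial n c =>
    refine ⟨Polynomial.monomial n (c / (2 * n + 1)), fun u => ?_⟩
    have h := (hasDerivAt_pow (2 * n + 1) u).const_mul (c / (2 * n + 1))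
    have hn : (2 * n + 1 : ℝ) ≠ 0 := by positivity
    have hf : (fun t : ℝ => t * (Polynomial.monomial n (c / (2 * n + 1))).eval (t ^ 2)) =
        fun t => c / (2 * n + 1) * t ^ (2 * n + 1) := by
      ext t
      rw [Polynomial.eval_monomial]
      ring
    rw [hf]
    refine h.congr_deriv ?_
    rw [Polynomial.eval_monomial]
    push_cast
    rw [← mul_assoc, div_mul_cancel₀ _ hn, pow_mul]

/-- Odd polynomials `t q(t²)` approximating the truncation of `t` to `[-1, 1]`, up to `ε` in norm,
with uniformly bounded derivative. -/
theorem exists_approx_truncation {R ε : ℝ} (hR : 0 ≤ R) (hε : 0 < ε) (hε1 : ε ≤ 1) :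
    ∃ q : Polynomial ℝ,
      (∀ u ∈ Set.Icc 0 R, |deriv (fun t => t * q.eval (t ^ 2)) u| ≤ 2) ∧
      (∀ u ∈ Set.Icc 0 R, |u * q.eval (u ^ 2)| ≤ 1) ∧
      (∀ u ∈ Set.Icc 0 1, 1 ≤ R → |u * q.eval (u ^ 2) - u| ≤ ε) := by
  -- The final error is at most `5η`: `η` from the approximation and `4η` from the rescaling by `c`.
  set η := ε / 6 with hη
  have hη0 : 0 < η := by positivity
  let k : ℝ → ℝ := fun v => max 0 (min 1 (1 + (1 - v) / η))
  have hk : ContinuousOn k (Set.Icc 0 (R ^ 2)) := by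
    apply Continuous.continuousOn
    fun_prop
  have hk0 : ∀ v, 0 ≤ k v := fun v => le_max_left _ _
  have hk1 : ∀ v, k v ≤ 1 := fun v => max_le zero_le_one (min_le_left _ _)
  have hk2 : ∀ v ≤ 1, k v = 1 := by
    intro v hv
    have : 0 ≤ (1 - v) / η := div_nonneg (by linarith) hη0.le
    simp only [k]
    rw [min_eq_left (by linarith), max_eq_right zero_le_one]
  have hk3 : ∀ v, 1 + η ≤ v → k v = 0 := by
    intro v hv
    have : (1 - v) / η ≤ -1 := by rw [div_le_iff₀ hη0]; linarith
    simp only [k]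
    exact max_eq_left ((min_le_right _ _).trans (by linarith))
  -- An error `ε'` in the derivative accumulates over a length of at most `R`, hence to at most `η`.
  set ε' := η / (R + 1) with hε'
  have hε'0 : 0 < ε' := by positivity
  have hε'R : ε' * R ≤ η := by
    rw [hε', div_mul_eq_mul_div, div_le_iff₀ (by positivity)]
    nlinarith
  have hε'1 : ε' ≤ η := div_le_self hη0.le (by linarith)
  obtain ⟨κ, hκ⟩ := exists_polynomial_near_of_continuousOn 0 (R ^ 2) k hk ε' hε'0
  obtain ⟨q, hq⟩ := exists_deriv_mul_eval_sq_eq κ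
  have hsq : ∀ u ∈ Set.Icc 0 R, u ^ 2 ∈ Set.Icc 0 (R ^ 2) := fun u hu =>
    ⟨sq_nonneg u, pow_le_pow_left₀ hu.1 hu.2 2⟩
  have hd : ∀ u ∈ Set.Icc 0 R, |κ.eval (u ^ 2) - k (u ^ 2)| ≤ ε' := fun u hu =>
    (hκ _ (hsq u hu)).le
  have hd1 : ∀ u ∈ Set.Icc 0 R, |κ.eval (u ^ 2)| ≤ 1 + ε' := by
    intro u hu
    have := hd u hu
    rw [abs_le] at this ⊢
    constructor <;> linarith [hk0 (u ^ 2), hk1 (u ^ 2), this.1, this.2]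
  have hb1 : ∀ u ∈ Set.Icc 0 R, u ≤ 1 + η → |u * q.eval (u ^ 2)| ≤ (1 + ε') * u := by
    intro u hu hu1
    have := (convex_Icc 0 R).norm_image_sub_le_of_norm_hasDerivWithin_le
      (fun v _ => (hq v).hasDerivWithinAt) hd1 ⟨le_rfl, hR⟩ hu
    simpa [abs_of_nonneg hu.1] using this
  -- Up to `1 + η` the value is at most `(1 + ε')(1 + η) ≤ 1 + 3η`; beyond, the target derivative
  -- vanishes and only the accumulated error `η` is added.
  have hb : ∀ u ∈ Set.Icc 0 R, |u * q.eval (u ^ 2)| ≤ 1 + 4 * η := by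
    intro u hu
    rcases le_total u (1 + η) with h | h
    · refine (hb1 u hu h).trans ?_
      nlinarith [hu.1]
    · have h1 : (1 + η) ∈ Set.Icc 0 R := ⟨by positivity, h.trans hu.2⟩
      have h2 := (convex_Icc (1 + η) R).norm_image_sub_le_of_norm_hasDerivWithin_le (C := ε')
        (fun v _ => (hq v).hasDerivWithinAt) (fun v hv => by
          have h3 := hd v ⟨h1.1.trans hv.1, hv.2⟩
          rwa [hk3 (v ^ 2) (by nlinarith [hv.1]), sub_zero] at h3) ⟨le_rfl, h1.2⟩ ⟨h, hu.2⟩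
      have h3 := hb1 _ h1 le_rfl
      have h4 : ε' * ‖u - (1 + η)‖ ≤ η := by
        refine le_trans ?_ hε'R
        rw [Real.norm_eq_abs, abs_of_nonneg (by linarith)]
        exact mul_le_mul_of_nonneg_left (by linarith [hu.2]) hε'0.le
      have h5 := (norm_le_norm_add_norm_sub' _ _).trans (add_le_add h3 (h2.trans h4))
      rw [Real.norm_eq_abs] at h5
      nlinarith
  have hc : ∀ u ∈ Set.Icc 0 1, 1 ≤ R → |u * q.eval (u ^ 2) - u| ≤ η := by
    intro u hu hR1
    have h2 := (convex_Icc 0 1).norm_image_sub_le_of_norm_hasDerivWithin_le (C := ε')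
      (f := fun t => t * q.eval (t ^ 2) - t)
      (fun v _ => ((hq v).sub (hasDerivAt_id v)).hasDerivWithinAt) (fun v hv => by
        have h3 := hd v ⟨hv.1, hv.2.trans hR1⟩
        rwa [hk2 (v ^ 2) (by nlinarith [hv.1, hv.2])] at h3) ⟨le_rfl, zero_le_one⟩ hu
    simp only [zero_mul, sub_zero, Real.norm_eq_abs, abs_of_nonneg hu.1] at h2
    nlinarith [hu.1, hu.2]
  -- Rescaling brings the bound `1 + 4η` down to exactly `1`.
  set c : ℝ := (1 + 4 * η)⁻¹ with hc_def
  have hc0 : 0 < c := by positivity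
  have hc1 : c ≤ 1 := inv_le_one_of_one_le₀ (by linarith)
  have hcη : c * (1 + 4 * η) = 1 := inv_mul_cancel₀ (by positivity)
  have he : ∀ u : ℝ, u * (Polynomial.C c * q).eval (u ^ 2) = c * (u * q.eval (u ^ 2)) := by
    intro u
    simp only [Polynomial.eval_mul, Polynomial.eval_C]
    ring
  refine ⟨Polynomial.C c * q, ?_, ?_, ?_⟩
  · intro u hu
    simp only [he]
    rw [((hq u).const_mul c).deriv, abs_mul, abs_of_pos hc0]
    have := hd1 u hu
    nlinarith [abs_nonneg (κ.eval (u ^ 2))]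
  · intro u hu
    rw [he, abs_mul, abs_of_pos hc0, ← hcη]
    exact mul_le_mul_of_nonneg_left (hb u hu) hc0.le
  · intro u hu hR1
    have h1 := hc u hu hR1
    rw [he, show c * (u * q.eval (u ^ 2)) - u = c * (u * q.eval (u ^ 2) - u) - (1 - c) * u by ring]
    have h2 : 1 - c ≤ 4 * η := by nlinarith
    rw [abs_le] at *
    constructor <;> nlinarith [hu.1, hu.2, h1.1, h1.2]

/-! ### The operator Lipschitz estimate. -/

/-- Operator Lipschitz estimate for `x ↦ x q(x⋆ x)`: the sequence `d k` has the values of a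
derivation on `x (x⋆ x)ᵏ`, where `x` acts by `a` on the left and by `b` on the right. -/
theorem norm_sum_smul_le {H : Type*} [NormedAddCommGroup H] [InnerProductSpace ℂ H]
    [CompleteSpace H] {q : Polynomial ℝ} {C R : ℝ}
    (hC : ∀ u ∈ Set.Icc 0 R, |deriv (fun t => t * q.eval (t ^ 2)) u| ≤ C)
    {a b : H →L[ℂ] H} (ha : ‖a‖ ≤ R) (hb : ‖b‖ ≤ R) (hab : Commute a b)
    (hab' : Commute a (star b)) {ξ ξ' : H} {d : ℕ → H} (hd0 : d 0 = ξ)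
    (hd : ∀ k, d (k + 1) = (a * (star a * a) ^ k) (star a ξ + b ξ') + (b * star b) (d k)) :
    ‖∑ k ∈ Finset.range (q.natDegree + 1), q.coeff k • d k‖ ≤ 3 * C * (‖ξ‖ + ‖ξ'‖) := by
  have hC0 : 0 ≤ C := (abs_nonneg _).trans (hC 0 ⟨le_rfl, (norm_nonneg a).trans ha⟩)
  set l := star a * a with hl
  set r := b * star b with hr
  -- Solving the recursion: the powers of `l` and `r` that accumulate are exactly those of
  -- `divDiffPow`.
  have hk : ∀ k, d k = (r ^ k) ξ + (a * divDiffPow k l r) (star a ξ + b ξ') := by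
    intro k
    induction k with
    | zero => simp [divDiffPow, hd0]
    | succ k ih =>
      have har : a * (r * divDiffPow k l r) = r * (a * divDiffPow k l r) := by
        rw [← mul_assoc, (hab.mul_right hab').eq, mul_assoc]
      rw [hd, ih, divDiffPow, mul_add, har, pow_succ', add_apply]
      simp only [mul_apply_eq_comp, map_add]
      abel
  have hsum : ∑ k ∈ Finset.range (q.natDegree + 1), q.coeff k • d k =
      (Polynomial.aeval r q) ξ + (a * divDiff q l r * star a) ξ + (a * divDiff q l r * b) ξ' := by
    have h1 : (Polynomial.aeval r q) ξ =
        ∑ k ∈ Finset.range (q.natDegree + 1), q.coeff k • (r ^ k) ξ := by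
      rw [Polynomial.aeval_eq_sum_range, sum_apply]
      rfl
    have h2 : ∀ η, (a * divDiff q l r) η =
        ∑ k ∈ Finset.range (q.natDegree + 1), q.coeff k • (a * divDiffPow k l r) η := by
      intro η
      rw [divDiff, Finset.mul_sum, sum_apply]
      refine Finset.sum_congr rfl fun k _ => ?_
      rw [mul_smul_comm]
      rfl
    rw [add_assoc, mul_apply_eq_comp _ (star a),
      mul_apply_eq_comp _ b, ← map_add, h1, h2, ← Finset.sum_add_distrib]
    exact Finset.sum_congr rfl fun k _ => by rw [hk, smul_add]
  obtain ⟨e1, e2, e3⟩ := norm_mul_divDiff_mul_le hC ha hb hab hab'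
  rw [hsum]
  have n1 := ContinuousLinearMap.le_of_opNorm_le _ e1 ξ
  have n2 := ContinuousLinearMap.le_of_opNorm_le _ e2 ξ
  have n3 := ContinuousLinearMap.le_of_opNorm_le _ e3 ξ'
  refine (norm_add₃_le).trans ?_
  nlinarith [mul_nonneg hC0 (norm_nonneg ξ')]

/-! ### Left and right multiplication on `L²(M, τ)`. -/

section Trace

variable {K : Type*} [NormedAddCommGroup K] [InnerProductSpace ℂ K] [CompleteSpace K]

theorem isClosed_elem (M : VonNeumannAlgebra K) :
    IsClosed (M.toStarSubalgebra : Set (K →L[ℂ] K)) := by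
  rw [VonNeumannAlgebra.coe_toStarSubalgebra, ← M.centralizer_centralizer]
  exact Set.isClosed_centralizer _

noncomputable instance instCStarAlgebraElem (M : VonNeumannAlgebra K) : CStarAlgebra (Elem M) :=
  StarSubalgebra.cstarAlgebra (h_closed := isClosed_elem M) M.toStarSubalgebra

/-- Writes `‖a‖² - a⋆ a` as a square, so that positivity of the trace on squares yields `‖x y‖₂ ≤
‖x‖ ‖y‖₂`. -/
theorem exists_star_mul_self_add {A : Type*} [CStarAlgebra A] (a : A) :
    ∃ c : A, star a * a + star c * c = ((‖a‖ ^ 2 : ℝ) : ℂ) • (1 : A) := by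
  let _ : PartialOrder A := CStarAlgebra.spectralOrder A
  have : StarOrderedRing A := CStarAlgebra.spectralOrderedRing A
  have h := CStarAlgebra.star_mul_le_algebraMap_norm_sq (a := a)
  obtain ⟨c, hc⟩ := CStarAlgebra.nonneg_iff_eq_star_mul_self.1 (sub_nonneg.2 h)
  refine ⟨c, ?_⟩
  rw [← hc, add_sub_cancel, Algebra.algebraMap_eq_smul_one, Complex.coe_smul]

variable {M : VonNeumannAlgebra K} (τ : FaithfulNormalTrace M)

theorem norm_toL2_sq (x : Elem M) : ‖toL2 τ x‖ ^ 2 = (τ.toFun (star x * x)).re := by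
  rw [← inner_toL2, ← inner_self_eq_norm_sq (𝕜 := ℂ)]
  rfl

theorem norm_toL2_mul_le (x y : Elem M) : ‖toL2 τ (x * y)‖ ≤ ‖x‖ * ‖toL2 τ y‖ := by
  refine le_of_sq_le_sq ?_ (by positivity)
  obtain ⟨c, hc⟩ := exists_star_mul_self_add x
  rw [mul_pow, norm_toL2_sq, norm_toL2_sq]
  have h1 : star (x * y) * (x * y) + star (c * y) * (c * y) =
      ((‖x‖ ^ 2 : ℝ) : ℂ) • (star y * y) := by
    calc _ = star y * (star x * x + star c * c) * y := by
          simp only [star_mul, mul_assoc, mul_add, add_mul]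
      _ = _ := by rw [hc]; simp
  have h2 := congrArg (fun z => (τ.toFun z).re) h1
  simp only [map_add, map_smul, Complex.add_re, smul_eq_mul, Complex.re_ofReal_mul] at h2
  have h3 := (Complex.nonneg_iff.1 (τ.nonneg (c * y))).1
  linarith

theorem norm_toL2_star (x : Elem M) : ‖toL2 τ (star x)‖ = ‖toL2 τ x‖ := by
  have h : ‖toL2 τ (star x)‖ ^ 2 = ‖toL2 τ x‖ ^ 2 := by
    rw [norm_toL2_sq, norm_toL2_sq, star_star, τ.tracial]
  exact (sq_eq_sq₀ (norm_nonneg _) (norm_nonneg _)).1 h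

theorem norm_toL2_mul_le' (x y : Elem M) : ‖toL2 τ (x * y)‖ ≤ ‖y‖ * ‖toL2 τ x‖ := by
  rw [← norm_toL2_star, star_mul, ← norm_toL2_star τ x, ← norm_star y]
  exact norm_toL2_mul_le τ _ _

theorem norm_toL2_le (x : Elem M) : ‖toL2 τ x‖ ≤ ‖x‖ := by
  have h1 : ‖toL2 τ 1‖ = 1 := by
    have h : ‖toL2 τ 1‖ ^ 2 = 1 ^ 2 := by simp [norm_toL2_sq, τ.map_one]
    exact (sq_eq_sq₀ (norm_nonneg _) zero_le_one).1 h
  simpa [h1] using norm_toL2_mul_le τ x 1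

theorem denseRange_toL2 : DenseRange (toL2 τ) :=
  (UniformSpace.Completion.denseRange_coe (α := PreL2 τ)).comp
    (toPreL2 τ).surjective.denseRange (UniformSpace.Completion.continuous_coe _)

/-- Left multiplication on `L²(M, τ)`. -/
noncomputable def leftL2 (x : Elem M) : L2 τ →L[ℂ] L2 τ :=
  (toL2 τ ∘ₗ LinearMap.mulLeft ℂ x).extendOfNorm (toL2 τ)

/-- Right multiplication on `L²(M, τ)`. -/
noncomputable def rightL2 (x : Elem M) : L2 τ →L[ℂ] L2 τ :=
  (toL2 τ ∘ₗ LinearMap.mulRight ℂ x).extendOfNorm (toL2 τ)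

@[simp]
theorem leftL2_toL2 (x y : Elem M) : leftL2 τ x (toL2 τ y) = toL2 τ (x * y) :=
  LinearMap.extendOfNorm_eq (denseRange_toL2 τ) ⟨‖x‖, fun y => norm_toL2_mul_le τ x y⟩ y

@[simp]
theorem rightL2_toL2 (x y : Elem M) : rightL2 τ x (toL2 τ y) = toL2 τ (y * x) :=
  LinearMap.extendOfNorm_eq (denseRange_toL2 τ) ⟨‖x‖, fun y => norm_toL2_mul_le' τ y x⟩ y

theorem norm_leftL2_le (x : Elem M) : ‖leftL2 τ x‖ ≤ ‖x‖ :=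
  LinearMap.opNorm_extendOfNorm_le (denseRange_toL2 τ) (norm_nonneg x) (norm_toL2_mul_le τ x)

theorem norm_rightL2_le (x : Elem M) : ‖rightL2 τ x‖ ≤ ‖x‖ :=
  LinearMap.opNorm_extendOfNorm_le (denseRange_toL2 τ) (norm_nonneg x)
    (fun y => norm_toL2_mul_le' τ y x)

theorem ext_toL2 {S T : L2 τ →L[ℂ] L2 τ} (h : ∀ y, S (toL2 τ y) = T (toL2 τ y)) : S = T :=
  ContinuousLinearMap.coeFn_injective
    ((denseRange_toL2 τ).equalizer S.continuous T.continuous (funext h))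

theorem eq_star_of_inner_toL2 {S T : L2 τ →L[ℂ] L2 τ}
    (h : ∀ y z, ⟪S (toL2 τ y), toL2 τ z⟫_ℂ = ⟪toL2 τ y, T (toL2 τ z)⟫_ℂ) : S = star T := by
  rw [ContinuousLinearMap.star_eq_adjoint, ContinuousLinearMap.eq_adjoint_iff]
  intro x y
  refine (denseRange_toL2 τ).induction_on₂
    (p := fun x y => ⟪S x, y⟫_ℂ = ⟪x, T y⟫_ℂ) ?_ h x y
  exact isClosed_eq (by fun_prop) (by fun_prop)

theorem star_leftL2 (x : Elem M) : star (leftL2 τ x) = leftL2 τ (star x) := by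
  refine (eq_star_of_inner_toL2 τ fun y z => ?_).symm
  simp only [leftL2_toL2, inner_toL2, star_mul, star_star, mul_assoc]

theorem star_rightL2 (x : Elem M) : star (rightL2 τ x) = rightL2 τ (star x) := by
  refine (eq_star_of_inner_toL2 τ fun y z => ?_).symm
  simp only [rightL2_toL2, inner_toL2, star_mul, star_star]
  rw [mul_assoc, τ.tracial, mul_assoc]

theorem commute_leftL2_rightL2 (x y : Elem M) : Commute (leftL2 τ x) (rightL2 τ y) :=
  ext_toL2 τ fun z => by simp [mul_assoc]

theorem leftL2_mul (x y : Elem M) : leftL2 τ (x * y) = leftL2 τ x * leftL2 τ y :=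
  ext_toL2 τ fun z => by simp [mul_assoc]

theorem leftL2_pow_toL2 (x y : Elem M) (k : ℕ) :
    (leftL2 τ x ^ k) (toL2 τ y) = toL2 τ (x ^ k * y) := by
  induction k with
  | zero => simp
  | succ k ih => simp [pow_succ', ih, mul_assoc]

/-- The map `x ↦ x q(x⋆ x)` is Lipschitz for `‖·‖₂` on norm-bounded sets. -/
theorem norm_toL2_mul_aeval_sub_le {q : Polynomial ℝ} {C R : ℝ}
    (hC : ∀ u ∈ Set.Icc 0 R, |deriv (fun t => t * q.eval (t ^ 2)) u| ≤ C)
    {x z : Elem M} (hx : ‖x‖ ≤ R) (hz : ‖z‖ ≤ R) :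
    ‖toL2 τ (x * Polynomial.aeval (star x * x) q) - toL2 τ (z * Polynomial.aeval (star z * z) q)‖
      ≤ 6 * C * ‖toL2 τ x - toL2 τ z‖ := by
  have h := norm_sum_smul_le hC (a := leftL2 τ x) (b := rightL2 τ z)
    ((norm_leftL2_le τ x).trans hx) ((norm_rightL2_le τ z).trans hz)
    -- With `x` on the left and `z` on the right, the differences `x (x⋆ x)ᵏ - z (z⋆ z)ᵏ` satisfy
    -- the same recursion as a derivation.
    (commute_leftL2_rightL2 τ x z) (by rw [star_rightL2]; exact commute_leftL2_rightL2 τ x _)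
    (ξ := toL2 τ (x - z)) (ξ' := toL2 τ (star (x - z)))
    (d := fun k => toL2 τ (x * (star x * x) ^ k - z * (star z * z) ^ k)) (by simp) (by
      intro k
      rw [star_leftL2, star_rightL2, ← leftL2_mul]
      simp only [mul_apply_eq_comp, leftL2_toL2, rightL2_toL2, ← map_add,
        leftL2_pow_toL2]
      congr 1
      rw [pow_succ (star x * x), pow_succ (star z * z), star_sub]
      noncomm_ring)
  have hs : ∀ y : Elem M, y * Polynomial.aeval (star y * y) q =
      ∑ k ∈ Finset.range (q.natDegree + 1), q.coeff k • (y * (star y * y) ^ k) := by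
    intro y
    simp only [Polynomial.aeval_eq_sum_range, Finset.mul_sum, mul_smul_comm]
  rw [← map_sub, hs, hs, ← Finset.sum_sub_distrib, map_sum]
  simp only [← smul_sub]
  have he : ∀ (c : ℝ) (y : Elem M), toL2 τ (c • y) = c • toL2 τ y := fun c y =>
    LinearMap.map_smul_of_tower (toL2 τ) c y
  simp only [he]
  refine h.trans (le_of_eq ?_)
  rw [norm_toL2_star, map_sub]
  ring

end Trace

/-! ### Weak limits in Hilbert spaces and von Neumann algebras. -/

section WeakLimits

/-- Banach–Alaoglu through the Riesz isomorphism; an ultrafilter replaces subsequences, so no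
separability is needed. -/
theorem exists_weak_limit {ι H : Type*} [NormedAddCommGroup H] [InnerProductSpace ℂ H]
    [CompleteSpace H] (U : Ultrafilter ι) {x : ι → H} {C : ℝ} (hx : ∀ i, ‖x i‖ ≤ C) :
    ∃ η : H, ‖η‖ ≤ C ∧ ∀ ζ, Tendsto (fun i => ⟪ζ, x i⟫_ℂ) U (𝓝 ⟪ζ, η⟫_ℂ) := by
  let f : ι → WeakDual ℂ H := fun i => StrongDual.toWeakDual (InnerProductSpace.toDual ℂ H (x i))
  have hf : ∀ i, f i ∈ WeakDual.toStrongDual ⁻¹' Metric.closedBall (0 : StrongDual ℂ H) C := by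
    intro i
    simpa [f] using hx i
  obtain ⟨F, hF, hFU⟩ := (WeakDual.isCompact_closedBall (0 : StrongDual ℂ H)
    C).ultrafilter_le_nhds (U.map f) (by
      rw [le_principal_iff]
      exact Filter.mem_map.2 (univ_mem' hf))
  refine ⟨(InnerProductSpace.toDual ℂ H).symm (WeakDual.toStrongDual F), by simpa using hF, ?_⟩
  intro ζ
  have h1 : Tendsto f U (𝓝 F) := hFU
  have h2 : Tendsto (fun i => f i ζ) U (𝓝 (F ζ)) :=
    ((WeakDual.eval_continuous ζ).tendsto F).comp h1
  have h3 := (Complex.continuous_conj.tendsto _).comp h2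
  rw [← inner_conj_symm, InnerProductSpace.toDual_symm_apply]
  refine Tendsto.congr (fun i => ?_) h3
  exact inner_conj_symm ζ (x i)

/-- Mazur's theorem: a point outside the closed convex hull would be strictly separated by a
functional, which the convergence preserves. -/
theorem mem_closure_of_weak_limit {ι E H : Type*} [NormedAddCommGroup E] [NormedSpace ℂ E]
    [NormedAddCommGroup H] [InnerProductSpace ℂ H] [CompleteSpace H] {l : Filter ι} [l.NeBot]
    {S : Set (E × H)} (hS : Convex ℝ S) {x : ι → E} {y : ι → H} (hxy : ∀ i, (x i, y i) ∈ S)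
    {e : E} {η : H} (hx : Tendsto x l (𝓝 e))
    (hy : ∀ ζ, Tendsto (fun i => ⟪ζ, y i⟫_ℂ) l (𝓝 ⟪ζ, η⟫_ℂ)) : (e, η) ∈ closure S := by
  by_contra hn
  obtain ⟨f, u, hfu, hu⟩ := RCLike.geometric_hahn_banach_closed_point (𝕜 := ℂ) hS.closure
    isClosed_closure hn
  set ζ := (InnerProductSpace.toDual ℂ H).symm (f ∘L ContinuousLinearMap.inr ℂ E H)
  have hf : ∀ a b, f (a, b) = f (a, 0) + ⟪ζ, b⟫_ℂ := by
    intro a b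
    rw [InnerProductSpace.toDual_symm_apply, ContinuousLinearMap.comp_apply,
      ContinuousLinearMap.inr_apply, ← map_add, Prod.mk_add_mk, add_zero, zero_add]
  have h1 : Tendsto (fun i => f (x i, y i)) l (𝓝 (f (e, η))) := by
    rw [hf e η, show (fun i => f (x i, y i)) = fun i => f (x i, 0) + ⟪ζ, y i⟫_ℂ from
      funext fun i => hf _ _]
    refine Tendsto.add ?_ (hy ζ)
    exact (Continuous.tendsto (by fun_prop : Continuous fun a => f (a, (0 : H))) e).comp hx
  have h2 := (Complex.continuous_re.tendsto _).comp h1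
  have h3 := le_of_tendsto h2 (Eventually.of_forall fun i =>
    (hfu _ (subset_closure (hxy i))).le)
  exact absurd hu (not_lt.2 h3)

variable {K : Type*} [NormedAddCommGroup K] [InnerProductSpace ℂ K] [CompleteSpace K]
  {M : VonNeumannAlgebra K}

theorem exists_weak_operator_limit {ι : Type*} (U : Ultrafilter ι) {x : ι → Elem M} {C : ℝ}
    (hx : ∀ i, ‖x i‖ ≤ C) : ∃ y : Elem M, ∀ ζ v,
      Tendsto (fun i => ⟪ζ, (x i : K →L[ℂ] K) v⟫_ℂ) U (𝓝 ⟪ζ, (y : K →L[ℂ] K) v⟫_ℂ) := by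
  have hb : ∀ v i, ‖(x i : K →L[ℂ] K) v‖ ≤ C * ‖v‖ := fun v i =>
    ContinuousLinearMap.le_of_opNorm_le _ (hx i) v
  choose L hLn hL using fun v => exists_weak_limit U (hb v)
  let T : K →L[ℂ] K := LinearMap.mkContinuous
    { toFun := L
      map_add' := fun v w => ext_inner_left ℂ fun ζ => by
        refine tendsto_nhds_unique (hL (v + w) ζ) ?_
        rw [inner_add_right]
        refine ((hL v ζ).add (hL w ζ)).congr fun i => ?_
        rw [map_add, inner_add_right]
      map_smul' := fun c v => ext_inner_left ℂ fun ζ => by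
        refine tendsto_nhds_unique (hL (c • v) ζ) ?_
        rw [RingHom.id_apply, inner_smul_right]
        refine ((hL v ζ).const_mul c).congr fun i => ?_
        rw [map_smul, inner_smul_right] } C hLn
  have hT : T ∈ M := by
    -- Commuting with each element of the commutant survives weak limits, so the bicommutant
    -- contains the limit.
    rw [← M.commutant_commutant, VonNeumannAlgebra.mem_commutant_iff]
    intro g hg
    rw [VonNeumannAlgebra.mem_commutant_iff] at hg
    ext v
    refine ext_inner_left ℂ fun ζ => ?_
    refine tendsto_nhds_unique ?_ (hL (g v) ζ)
    have h := hL v (star g ζ)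
    simp only [ContinuousLinearMap.star_eq_adjoint, ContinuousLinearMap.adjoint_inner_left] at h
    refine h.congr fun i => ?_
    have := congrArg (fun S : K →L[ℂ] K => S v) (hg (x i) (x i).2)
    exact congrArg _ this.symm
  exact ⟨⟨T, hT⟩, fun ζ v => hL v ζ⟩

theorem tendsto_sigmaWeakOn {ι : Type*} {l : Filter ι} {x : ι → Elem M} {y : Elem M} {C : ℝ}
    (hx : ∀ i, ‖x i‖ ≤ C)
    (h : ∀ ζ v, Tendsto (fun i => ⟪ζ, (x i : K →L[ℂ] K) v⟫_ℂ) l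
      (𝓝 ⟪ζ, (y : K →L[ℂ] K) v⟫_ℂ)) :
    Tendsto x l (@nhds _ (sigmaWeakOn M) y) := by
  simp only [nhds_induced, tendsto_comap_iff, tendsto_pi_nhds, Function.comp_def]
  rintro ⟨ξ, η⟩
  have hs : ∀ ζ : lp (fun _ : ℕ => K) 2, Summable fun n => ‖ζ n‖ ^ 2 := fun ζ => by
    simpa using (lp.memℓp ζ).summable (by norm_num)
  refine tendsto_tsum_of_dominated_convergence (((hs ξ).add (hs η)).mul_left C)
    (fun n => h (ξ n) (η n)) (Eventually.of_forall fun i n => ?_)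
  have hC : 0 ≤ C := (norm_nonneg _).trans (hx i)
  have h1 : ‖(x i : K →L[ℂ] K) (η n)‖ ≤ C * ‖η n‖ := ContinuousLinearMap.le_of_opNorm_le _ (hx i) _
  calc _ ≤ ‖ξ n‖ * ‖(x i : K →L[ℂ] K) (η n)‖ := norm_inner_le_norm _ _
    _ ≤ ‖ξ n‖ * (C * ‖η n‖) := mul_le_mul_of_nonneg_left h1 (norm_nonneg _)
    _ = C * (‖ξ n‖ * ‖η n‖) := by ring
    _ ≤ _ := mul_le_mul_of_nonneg_left
      (by nlinarith [sq_nonneg (‖ξ n‖ - ‖η n‖), sq_nonneg (‖ξ n‖), sq_nonneg (‖η n‖)]) hC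

theorem tendsto_inner_of_sigmaWeak {ι K : Type*} [NormedAddCommGroup K] [InnerProductSpace ℂ K]
    {l : Filter ι} {x : ι → K →L[ℂ] K}
    {y : K →L[ℂ] K} (h : Tendsto x l (@nhds _ (sigmaWeak K) y)) (ζ v : K) :
    Tendsto (fun i => ⟪ζ, x i v⟫_ℂ) l (𝓝 ⟪ζ, y v⟫_ℂ) := by
  simp only [nhds_induced, tendsto_comap_iff, tendsto_pi_nhds, Function.comp_def] at h
  have h1 := h (lp.single 2 0 ζ, lp.single 2 0 v)
  have h2 : ∀ T : K →L[ℂ] K, ∑' n : ℕ, ⟪(lp.single 2 0 ζ : lp (fun _ : ℕ => K) 2) n,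
      T ((lp.single 2 0 v : lp (fun _ : ℕ => K) 2) n)⟫_ℂ = ⟪ζ, T v⟫_ℂ := by
    intro T
    rw [tsum_eq_single 0]
    · simp
    · intro n hn
      simp [lp.single_apply, hn]
  simpa only [h2] using h1

/-- On norm-bounded sets, `‖·‖₂`-convergence implies σ-weak convergence. -/
theorem tendsto_sigmaWeakOn_of_toL2 (τ : FaithfulNormalTrace M) {x : ℕ → Elem M} {y : Elem M}
    {C : ℝ} (hx : ∀ i, ‖x i‖ ≤ C) (h : Tendsto (fun n => toL2 τ (x n)) atTop (𝓝 (toL2 τ y))) :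
    Tendsto x atTop (@nhds _ (sigmaWeakOn M) y) := by
  refine (tendsto_iff_ultrafilter _ _ _).2 fun U hU => ?_
  obtain ⟨z, hz⟩ := exists_weak_operator_limit U hx
  -- Normality of the trace and `‖·‖₂`-convergence compute the same limit of `τ(w⋆ x n)` for `w = z
  -- - y`, forcing `τ(w⋆ w) = 0`.
  have hzy : z = y := by
    rw [← sub_eq_zero]
    refine τ.faithful _ ?_
    set w := z - y with hw
    have h1 : Tendsto (fun n => star w * x n) U (@nhds _ (sigmaWeakOn M) (star w * z)) := by
      refine tendsto_sigmaWeakOn (C := ‖w‖ * C) (fun i => ?_) fun ζ v => ?_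
      · refine (norm_mul_le _ _).trans ?_
        rw [norm_star]
        exact mul_le_mul_of_nonneg_left (hx i) (norm_nonneg _)
      · have h2 := hz ((w : K →L[ℂ] K) ζ) v
        simpa [ContinuousLinearMap.star_eq_adjoint, ContinuousLinearMap.adjoint_inner_right]
          using h2
    have h2 := (@Continuous.tendsto _ _ (sigmaWeakOn M) _ _ τ.normal (star w * z)).comp h1
    have h3 : Tendsto (fun n => ⟪toL2 τ w, toL2 τ (x n)⟫_ℂ) U (𝓝 ⟪toL2 τ w, toL2 τ y⟫_ℂ) :=
      tendsto_const_nhds.inner (h.mono_left hU)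
    simp only [inner_toL2] at h3
    have h4 := tendsto_nhds_unique h2 h3
    rw [hw, mul_sub, map_sub, ← hw, h4, sub_self]
  rw [← hzy]
  exact tendsto_sigmaWeakOn hx hz

end WeakLimits

/-! ### Derivations and the graph of the closure. -/

section Derivations

theorem tendsto_inner_apply {H : Type*} [NormedAddCommGroup H] [InnerProductSpace ℂ H]
    {A : ℕ → H →L[ℂ] H} {T : H →L[ℂ] H} {v : ℕ → H} {w : H} {C : ℝ}
    (hA : ∀ n, ‖A n‖ ≤ C) (hAT : Tendsto A atTop (@nhds _ (sigmaWeak H) T))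
    (hv : Tendsto v atTop (𝓝 w)) (ζ : H) :
    Tendsto (fun n => ⟪ζ, A n (v n)⟫_ℂ) atTop (𝓝 ⟪ζ, T w⟫_ℂ) := by
  have h1 : Tendsto (fun n => A n (v n - w)) atTop (𝓝 0) := by
    rw [tendsto_iff_norm_sub_tendsto_zero] at hv
    refine squeeze_zero_norm (fun n => ContinuousLinearMap.le_of_opNorm_le _ (hA n) _) ?_
    simpa using hv.const_mul C
  have h2 := (tendsto_const_nhds (x := ζ)).inner (𝕜 := ℂ) h1
  have h3 := h2.add (tendsto_inner_of_sigmaWeak hAT ζ w)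
  rw [inner_zero_right, zero_add] at h3
  refine h3.congr fun n => ?_
  rw [← inner_add_right, map_sub, sub_add_cancel]

variable {K : Type*} [NormedAddCommGroup K] [InnerProductSpace ℂ K] [CompleteSpace K]
  {M : VonNeumannAlgebra K} {H : Type*} [NormedAddCommGroup H] [InnerProductSpace ℂ H]
  [CompleteSpace H] {B : InvolutiveBimodule M H}

theorem InvolutiveBimodule.norm_left_le (B : InvolutiveBimodule M H) (x : Elem M) :
    ‖B.left x‖ ≤ ‖x‖ :=
  NonUnitalStarAlgHom.norm_apply_le B.left x

theorem InvolutiveBimodule.norm_right_le (B : InvolutiveBimodule M H) (x : Elem M) :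
    ‖B.right (op x)‖ ≤ ‖x‖ :=
  NonUnitalStarAlgHom.norm_apply_le B.right (op x)

theorem InvolutiveBimodule.commute (B : InvolutiveBimodule M H) (x y : Elem M) :
    Commute (B.left x) (B.right (op y)) :=
  ContinuousLinearMap.ext fun ξ => B.left_right_comm x y ξ

namespace SymmetricDerivation

variable (δ : SymmetricDerivation B)

set_option synthInstance.maxHeartbeats 200000 in
noncomputable instance instSMulDomain : SMul ℂ δ.domain :=
  (inferInstance : Module ℂ δ.domain).toSMul

/-- The element `x (x⋆ x)ᵏ` of the domain. -/
noncomputable def mulPow (x : δ.domain) : ℕ → δ.domain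
  | 0 => x
  | k + 1 => mulPow x k * (star x * x)

theorem coe_mulPow (x : δ.domain) (k : ℕ) :
    (δ.mulPow x k : Elem M) = x * (star (x : Elem M) * x) ^ k := by
  induction k with
  | zero => simp [mulPow]
  | succ k ih =>
    rw [pow_succ, ← mul_assoc, ← ih]
    rfl

theorem exists_mul_aeval {q : Polynomial ℝ} {C R : ℝ}
    (hC : ∀ u ∈ Set.Icc 0 R, |deriv (fun t => t * q.eval (t ^ 2)) u| ≤ C)
    (x : δ.domain) (hx : ‖(x : Elem M)‖ ≤ R) :
    ∃ y : δ.domain, (y : Elem M) = x * Polynomial.aeval (star (x : Elem M) * x) q ∧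
      ‖δ.toFun y‖ ≤ 6 * C * ‖δ.toFun x‖ := by
  refine ⟨∑ k ∈ Finset.range (q.natDegree + 1), (q.coeff k : ℂ) • δ.mulPow x k, ?_, ?_⟩
  · rw [Polynomial.aeval_eq_sum_range, Finset.mul_sum, AddSubmonoidClass.coe_finsetSum]
    refine Finset.sum_congr rfl fun k _ => ?_
    rw [mul_smul_comm, ← coe_mulPow, ← Complex.coe_smul]
    rfl
  · rw [map_sum]
    simp only [map_smul]
    simp only [Complex.coe_smul]
    have hr : star (B.right (op (x : Elem M))) = B.right (op (star (x : Elem M))) :=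
      (map_star B.right _).symm
    refine (norm_sum_smul_le hC (a := B.left x) (b := B.right (op (x : Elem M)))
      ((B.norm_left_le x).trans hx) ((B.norm_right_le x).trans hx) (B.commute _ _)
      (by rw [hr]; exact B.commute _ _) (ξ := δ.toFun x) (ξ' := B.J (δ.toFun x))
      (d := fun k => δ.toFun (δ.mulPow x k)) rfl ?_).trans (le_of_eq ?_)
    · intro k
      simp only [mulPow]
      -- The right action is through the opposite algebra, so `x⋆ x` acts on the right as `b * star
      -- b`.
      rw [hr, ← map_star, ← map_mul, ← map_mul, ← map_pow, ← map_mul, ← op_mul, δ.leibniz,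
        δ.leibniz, δ.symmetric, coe_mulPow]
      rfl
    · rw [LinearIsometry.norm_map]
      ring

variable (τ : FaithfulNormalTrace M)

theorem graph_toLinearPMap :
    ((δ.toLinearPMap τ).graph : Set (L2 τ × H)) =
      Set.range fun x : δ.domain => (toL2 τ x, δ.toFun x) := by
  ext p
  rw [SetLike.mem_coe, LinearPMap.mem_graph_iff']
  constructor
  · rintro ⟨⟨e, x, hx, rfl⟩, rfl⟩
    exact ⟨⟨x, hx⟩, Prod.ext rfl (δ.toLinearPMap_apply τ ⟨x, hx⟩ _).symm⟩
  · rintro ⟨x, rfl⟩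
    exact ⟨⟨toL2 τ x, (x : Elem M), x.2, rfl⟩, Prod.ext rfl (δ.toLinearPMap_apply τ x _)⟩

variable {δ τ}

theorem graph_bar (h : (δ.toLinearPMap τ).IsClosable) :
    ((δ.bar τ).graph : Set (L2 τ × H)) =
      closure (Set.range fun x : δ.domain => (toL2 τ x, δ.toFun x)) := by
  rw [← graph_toLinearPMap, ← Submodule.topologicalClosure_coe,
    h.graph_closure_eq_closure_graph]
  rfl

theorem exists_seq_of_mem_graph_bar (h : (δ.toLinearPMap τ).IsClosable) {e : L2 τ} {η : H}
    (he : (e, η) ∈ (δ.bar τ).graph) : ∃ X : ℕ → δ.domain,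
      Tendsto (fun n => toL2 τ (X n)) atTop (𝓝 e) ∧
      Tendsto (fun n => δ.toFun (X n)) atTop (𝓝 η) := by
  rw [← SetLike.mem_coe, graph_bar h] at he
  obtain ⟨p, hp, hlim⟩ := mem_closure_iff_seq_limit.1 he
  choose X hX using hp
  rw [show p = fun n => (toL2 τ (X n), δ.toFun (X n)) from (funext hX).symm] at hlim
  exact ⟨X, hlim.fst_nhds, hlim.snd_nhds⟩

theorem mem_graph_bar_of_tendsto (h : (δ.toLinearPMap τ).IsClosable) {ι : Type*} {l : Filter ι}
    [l.NeBot] {X : ι → δ.domain} {e : L2 τ} {η : H}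
    (h1 : Tendsto (fun n => toL2 τ (X n)) l (𝓝 e))
    (h2 : ∀ ζ, Tendsto (fun n => ⟪ζ, δ.toFun (X n)⟫_ℂ) l (𝓝 ⟪ζ, η⟫_ℂ)) :
    (e, η) ∈ (δ.bar τ).graph := by
  have hc : Convex ℝ ((δ.bar τ).graph : Set (L2 τ × H)) :=
    ((δ.bar τ).graph.restrictScalars ℝ).convex
  have := mem_closure_of_weak_limit (l := l) hc (x := fun n => toL2 τ (X n))
    (y := fun n => δ.toFun (X n)) (fun i => by
      rw [graph_bar h]
      exact subset_closure ⟨X i, rfl⟩) h1 h2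
  rwa [graph_bar h, closure_closure, ← graph_bar h] at this

theorem convex_image_ball (δ : SymmetricDerivation B) (τ : FaithfulNormalTrace M) :
    Convex ℝ ((fun x : δ.domain => (toL2 τ x, δ.toFun x)) '' {x | ‖(x : Elem M)‖ ≤ 1}) := by
  rintro _ ⟨x, hx, rfl⟩ _ ⟨y, hy, rfl⟩ a b ha hb hab
  refine ⟨(a : ℂ) • x + (b : ℂ) • y, ?_, ?_⟩
  · have h1 : ‖(a : ℂ) • (x : Elem M) + (b : ℂ) • (y : Elem M)‖ ≤ 1 := by
      refine (norm_add_le _ _).trans ?_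
      rw [norm_smul, norm_smul, Complex.norm_real, Complex.norm_real, Real.norm_of_nonneg ha,
        Real.norm_of_nonneg hb]
      simp only [Set.mem_ofPred_eq] at hx hy
      nlinarith
    exact h1
  · have h1 : toL2 τ ((a : ℂ) • (x : Elem M) + (b : ℂ) • (y : Elem M)) =
        a • toL2 τ x + b • toL2 τ y := by
      rw [map_add, map_smul, map_smul, Complex.coe_smul, Complex.coe_smul]
    refine Prod.ext h1 ?_
    change δ.toFun ((a : ℂ) • x + (b : ℂ) • y) = a • δ.toFun x + b • δ.toFun y
    rw [map_add, map_smul, map_smul, Complex.coe_smul, Complex.coe_smul]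

/-! ### Kaplansky density in graph norm. -/

/-- A Kaplansky density theorem for the graph norm of a closable symmetric derivation. -/
theorem exists_seq_unit_ball (h : (δ.toLinearPMap τ).IsClosable) {Z : Elem M} (hZ : ‖Z‖ ≤ 1)
    {η : H} (hη : (toL2 τ Z, η) ∈ (δ.bar τ).graph) : ∃ Y : ℕ → δ.domain,
      (∀ n, ‖(Y n : Elem M)‖ ≤ 1) ∧
      Tendsto (fun n => toL2 τ (Y n)) atTop (𝓝 (toL2 τ Z)) ∧
      Tendsto (fun n => δ.toFun (Y n)) atTop (𝓝 η) := by
  obtain ⟨X, hX, hδX⟩ := exists_seq_of_mem_graph_bar h hη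
  obtain ⟨D, hD⟩ := hδX.norm.bddAbove_range
  have hD' : ∀ n, ‖δ.toFun (X n)‖ ≤ D := fun n => hD ⟨n, rfl⟩
  -- The norms of `X n` may be unbounded, so the interval varies with `n`; only the derivative bound
  -- `2` is uniform.
  have hR : ∀ n, 0 ≤ max 1 ‖(X n : Elem M)‖ := fun n => zero_le_one.trans (le_max_left _ _)
  have hε : ∀ n : ℕ, (0 : ℝ) < 1 / (n + 1) := fun n => Nat.one_div_pos_of_nat
  choose q hq1 hq2 hq3 using fun n : ℕ => exists_approx_truncation (hR n) (hε n)
    (by rw [div_le_one (by positivity)]; linarith [n.cast_nonneg (α := ℝ)])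
  choose Y hY hδY using fun n => δ.exists_mul_aeval (hq1 n) (X n) (le_max_right _ _)
  have hYn : ∀ n, ‖(Y n : Elem M)‖ ≤ 1 := fun n => by
    rw [hY]
    exact norm_mul_aeval_le zero_le_one (le_max_right _ _) (hq2 n)
  have hYZ : Tendsto (fun n => toL2 τ (Y n)) atTop (𝓝 (toL2 τ Z)) := by
    rw [tendsto_iff_norm_sub_tendsto_zero] at hX ⊢
    refine squeeze_zero (g := fun n : ℕ => 6 * 2 * ‖toL2 τ (X n) - toL2 τ Z‖ + 1 / (n + 1 : ℝ))
      (fun n => norm_nonneg _) (fun n => ?_) ?_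
    · have h1 := norm_toL2_mul_aeval_sub_le τ (hq1 n) (le_max_right 1 ‖(X n : Elem M)‖)
        (hZ.trans (le_max_left _ _))
      -- As `‖Z‖ ≤ 1`, only the interval `[0, 1]` matters, where `t q(t²)` is close to `t`.
      have h2 : ‖Z * Polynomial.aeval (star Z * Z) (q n - 1)‖ ≤ 1 / (n + 1 : ℝ) := by
        refine norm_mul_aeval_le (hε n).le hZ fun u hu => ?_
        have := hq3 n u hu (le_max_left _ _)
        rwa [Polynomial.eval_sub, Polynomial.eval_one, mul_sub, mul_one]
      rw [map_sub, map_one, mul_sub, mul_one] at h2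
      have h3 := (norm_toL2_le τ _).trans h2
      rw [map_sub] at h3
      rw [hY]
      exact (norm_sub_le_norm_sub_add_norm_sub _ _ _).trans (add_le_add h1 h3)
    · simpa using (hX.const_mul (6 * 2)).add (tendsto_one_div_add_atTop_nhds_zero_nat (𝕜 := ℝ))
  obtain ⟨η', -, hη'⟩ := exists_weak_limit (hyperfilter ℕ) (x := fun n => δ.toFun (Y n))
    (C := 6 * 2 * D) fun n => (hδY n).trans (mul_le_mul_of_nonneg_left (hD' n) (by norm_num))
  have hU : ((hyperfilter ℕ : Ultrafilter ℕ) : Filter ℕ) ≤ atTop := Nat.hyperfilter_le_atTop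
  have hg := mem_graph_bar_of_tendsto h (hYZ.mono_left hU) hη'
  obtain rfl : η' = η := LinearPMap.mem_graph_snd_inj _ hg hη rfl
  -- Mazur again, now inside the unit ball: convex combinations of the `Y n` converge in graph norm.
  have hcl := mem_closure_of_weak_limit (convex_image_ball δ τ)
    (x := fun n => toL2 τ (Y n)) (y := fun n => δ.toFun (Y n)) (fun n => ⟨Y n, hYn n, rfl⟩)
    (hYZ.mono_left hU) hη'
  obtain ⟨p, hp, hlim⟩ := mem_closure_iff_seq_limit.1 hcl
  choose W hW hWp using hp
  rw [show p = fun n => (toL2 τ (W n), δ.toFun (W n)) from (funext hWp).symm] at hlim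
  exact ⟨W, hW, hlim.fst_nhds, hlim.snd_nhds⟩

theorem exists_seq_norm_le (h : (δ.toLinearPMap τ).IsClosable) {Z : Elem M}
    {η : H} (hη : (toL2 τ Z, η) ∈ (δ.bar τ).graph) : ∃ Y : ℕ → δ.domain,
      (∀ n, ‖(Y n : Elem M)‖ ≤ ‖Z‖) ∧
      Tendsto (fun n => toL2 τ (Y n)) atTop (𝓝 (toL2 τ Z)) ∧
      Tendsto (fun n => δ.toFun (Y n)) atTop (𝓝 η) := by
  by_cases hZ0 : Z = 0
  · subst hZ0
    obtain rfl : η = 0 := LinearPMap.graph_fst_eq_zero_snd _ hη (map_zero _)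
    exact ⟨fun _ => 0, by simp, by simp, by simp⟩
  have hn : (‖Z‖ : ℂ) ≠ 0 := by exact_mod_cast norm_ne_zero_iff.2 hZ0
  have h1 : ‖(‖Z‖ : ℂ)⁻¹ • Z‖ ≤ 1 := by
    rw [norm_smul, norm_inv, Complex.norm_real, norm_norm,
      inv_mul_cancel₀ (norm_ne_zero_iff.2 hZ0)]
  have h2 := (δ.bar τ).graph.smul_mem ((‖Z‖ : ℂ)⁻¹) hη
  rw [Prod.smul_mk, ← map_smul] at h2
  obtain ⟨Y, hY1, hY2, hY3⟩ := exists_seq_unit_ball h h1 h2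
  refine ⟨fun n => (‖Z‖ : ℂ) • Y n, fun n => ?_, ?_, ?_⟩
  · change ‖(‖Z‖ : ℂ) • (Y n : Elem M)‖ ≤ ‖Z‖
    rw [norm_smul, Complex.norm_real, norm_norm]
    exact mul_le_of_le_one_right (norm_nonneg _) (hY1 n)
  · have h3 := hY2.const_smul (‖Z‖ : ℂ)
    rw [← map_smul, smul_inv_smul₀ hn] at h3
    exact h3.congr fun n => (map_smul (toL2 τ) _ _).symm
  · have h3 := hY3.const_smul (‖Z‖ : ℂ)
    rw [smul_inv_smul₀ hn] at h3
    exact h3.congr fun n => (map_smul δ.toFun _ _).symm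

/-! ### Products and adjoints in the graph of the closure. -/

theorem mul_mem_graph_bar (h : (δ.toLinearPMap τ).IsClosable) {x y : Elem M} {ξ η : H}
    {X Y : ℕ → δ.domain} {C C' : ℝ}
    (hX : ∀ n, ‖(X n : Elem M)‖ ≤ C) (hY : ∀ n, ‖(Y n : Elem M)‖ ≤ C')
    (hXx : Tendsto (fun n => toL2 τ (X n)) atTop (𝓝 (toL2 τ x)))
    (hYy : Tendsto (fun n => toL2 τ (Y n)) atTop (𝓝 (toL2 τ y)))
    (hδX : Tendsto (fun n => δ.toFun (X n)) atTop (𝓝 ξ))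
    (hδY : Tendsto (fun n => δ.toFun (Y n)) atTop (𝓝 η)) :
    (toL2 τ (x * y), B.left x η + B.right (op y) ξ) ∈ (δ.bar τ).graph := by
  refine mem_graph_bar_of_tendsto h (l := atTop) (X := fun n => X n * Y n) ?_ fun ζ => ?_
  · rw [tendsto_iff_norm_sub_tendsto_zero] at hXx hYy ⊢
    refine squeeze_zero (g := fun n => C * ‖toL2 τ (Y n) - toL2 τ y‖ +
      ‖y‖ * ‖toL2 τ (X n) - toL2 τ x‖) (fun n => norm_nonneg _) (fun n => ?_)
      (by simpa using (hYy.const_mul C).add (hXx.const_mul ‖y‖))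
    have h1 : toL2 τ ((X n : Elem M) * (Y n : Elem M)) - toL2 τ (x * y) =
        toL2 τ ((X n : Elem M) * ((Y n : Elem M) - y)) + toL2 τ (((X n : Elem M) - x) * y) := by
      rw [← map_sub, ← map_add]
      congr 1
      noncomm_ring
    change ‖toL2 τ ((X n : Elem M) * (Y n : Elem M)) - toL2 τ (x * y)‖ ≤ _
    rw [h1]
    refine (norm_add_le _ _).trans (add_le_add ?_ ?_)
    · rw [← map_sub]
      exact (norm_toL2_mul_le τ _ _).trans
        (mul_le_mul_of_nonneg_right (hX n) (norm_nonneg _))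
    · rw [← map_sub]
      exact norm_toL2_mul_le' τ _ _
  · simp only [δ.leibniz, inner_add_right]
    refine Tendsto.add ?_ ?_
    -- The operators converge σ-weakly and stay bounded while the vectors converge in norm, so their
    -- pairing converges weakly.
    · exact tendsto_inner_apply (fun n => (B.norm_left_le _).trans (hX n))
        ((@Continuous.tendsto _ _ (sigmaWeakOn M) (sigmaWeak H) _ B.left_normal x).comp
          (tendsto_sigmaWeakOn_of_toL2 τ hX hXx)) hδY ζ
    · exact tendsto_inner_apply (fun n => (B.norm_right_le _).trans (hY n))
        ((@Continuous.tendsto _ _ (sigmaWeakOn M) (sigmaWeak H) _ B.right_normal y).comp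
          (tendsto_sigmaWeakOn_of_toL2 τ hY hYy)) hδX ζ

theorem star_mem_graph_bar (h : (δ.toLinearPMap τ).IsClosable) {x : Elem M} {ξ : H}
    (hx : (toL2 τ x, ξ) ∈ (δ.bar τ).graph) :
    (toL2 τ (star x), B.J ξ) ∈ (δ.bar τ).graph := by
  obtain ⟨X, hX, hδX⟩ := exists_seq_of_mem_graph_bar h hx
  refine mem_graph_bar_of_tendsto h (l := atTop) (X := fun n => star (X n)) ?_ fun ζ => ?_
  · rw [tendsto_iff_norm_sub_tendsto_zero] at hX ⊢
    refine hX.congr fun n => ?_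
    rw [← map_sub, ← norm_toL2_star, star_sub, map_sub]
    rfl
  · simp only [δ.symmetric]
    exact tendsto_const_nhds.inner ((B.J.continuous.tendsto ξ).comp hδX)

/-- If elements of `D(δ̄) ∩ M` have norm-bounded approximants in `D(δ)` for the graph norm, then
`D(δ̄) ∩ M` is a *-algebra and `δ̄` restricts to a symmetric derivation on it. -/
noncomputable def restrictBar (δ : SymmetricDerivation B) (τ : FaithfulNormalTrace M)
    (h : (δ.toLinearPMap τ).IsClosable)
    (happrox : ∀ (Z : Elem M) (hZ : toL2 τ Z ∈ (δ.bar τ).domain), ∃ Y : ℕ → δ.domain,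
      (∀ n, ‖(Y n : Elem M)‖ ≤ ‖Z‖) ∧
      Tendsto (fun n => toL2 τ (Y n)) atTop (𝓝 (toL2 τ Z)) ∧
      Tendsto (fun n => δ.toFun (Y n)) atTop (𝓝 (δ.bar τ ⟨toL2 τ Z, hZ⟩))) :
    SymmetricDerivation B :=
  have hmul : ∀ (x y : Elem M) (hx : toL2 τ x ∈ (δ.bar τ).domain)
      (hy : toL2 τ y ∈ (δ.bar τ).domain),
      (toL2 τ (x * y), B.left x (δ.bar τ ⟨toL2 τ y, hy⟩) +
        B.right (op y) (δ.bar τ ⟨toL2 τ x, hx⟩)) ∈ (δ.bar τ).graph := by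
    intro x y hx hy
    obtain ⟨X, hX1, hX2, hX3⟩ := happrox x hx
    obtain ⟨Y, hY1, hY2, hY3⟩ := happrox y hy
    exact mul_mem_graph_bar h hX1 hY1 hX2 hY2 hX3 hY3
  have hstar : ∀ (x : Elem M) (hx : toL2 τ x ∈ (δ.bar τ).domain),
      (toL2 τ (star x), B.J (δ.bar τ ⟨toL2 τ x, hx⟩)) ∈ (δ.bar τ).graph := fun x hx =>
    star_mem_graph_bar h ((δ.bar τ).mem_graph ⟨toL2 τ x, hx⟩)
  { domain :=
      { (δ.bar τ).domain.comap (toL2 τ) with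
        mul_mem' := fun {x y} hx hy => LinearPMap.mem_domain_of_mem_graph (hmul x y hx hy)
        star_mem' := fun {x} hx => LinearPMap.mem_domain_of_mem_graph (hstar x hx) }
    toFun :=
      { toFun := fun x => δ.bar τ ⟨toL2 τ (x : Elem M), x.2⟩
        map_add' := fun x y => by
          rw [← LinearPMap.map_add]
          exact congrArg _ (Subtype.ext (map_add (toL2 τ) _ _))
        map_smul' := fun c x => by
          rw [RingHom.id_apply, ← LinearPMap.map_smul]
          exact congrArg _ (Subtype.ext (map_smul (toL2 τ) _ _)) }
    leibniz := fun x y => LinearPMap.mem_graph_snd_inj _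
      ((δ.bar τ).mem_graph ⟨toL2 τ ((x : Elem M) * (y : Elem M)), _⟩) (hmul x y x.2 y.2) rfl
    symmetric := fun x => LinearPMap.mem_graph_snd_inj _
      ((δ.bar τ).mem_graph ⟨toL2 τ (star (x : Elem M)), _⟩) (hstar x x.2) rfl }

end SymmetricDerivation
end Derivations
end VNDerivation

theorem mainTheorem6 {K : Type*} [NormedAddCommGroup K] [InnerProductSpace ℂ K] [CompleteSpace K]
    (M : VonNeumannAlgebra K) (τ : FaithfulNormalTrace M)
    {H : Type*} [NormedAddCommGroup H] [InnerProductSpace ℂ H] [CompleteSpace H]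
    (B : InvolutiveBimodule M H) (δ : SymmetricDerivation B)
    (hdense : δ.WeaklyDense) (hclosable : (δ.toLinearPMap τ).IsClosable) :
    (∃ δ' : SymmetricDerivation B,
      (∀ x : Elem M, x ∈ δ'.domain ↔ toL2 τ x ∈ (δ.bar τ).domain) ∧
      ∀ (x : δ'.domain) (hx : toL2 τ x ∈ (δ.bar τ).domain),
        δ'.toFun x = δ.bar τ ⟨toL2 τ x, hx⟩) ↔
    (∀ (Z : Elem M) (hZ : toL2 τ Z ∈ (δ.bar τ).domain),
      ∃ Zn : ℕ → δ.domain,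
        (∀ n, ‖((Zn n : Elem M) : K →L[ℂ] K)‖ ≤ ‖(Z : K →L[ℂ] K)‖) ∧
        Tendsto (fun n => ‖toL2 τ (Zn n) - toL2 τ Z‖) atTop (𝓝 0) ∧
        Tendsto (fun n => ‖δ.toFun (Zn n) - δ.bar τ ⟨toL2 τ Z, hZ⟩‖) atTop (𝓝 0)) := by
  simp only [← tendsto_iff_norm_sub_tendsto_zero]
  constructor
  · intro _ Z hZ
    exact SymmetricDerivation.exists_seq_norm_le hclosable
      ((δ.bar τ).mem_graph ⟨toL2 τ Z, hZ⟩)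
  · intro happrox
    exact ⟨δ.restrictBar τ hclosable happrox, fun x => Iff.rfl, fun x hx => rfl⟩
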